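/- Let $\Lambda\subset\mathbb{C}^2$ be a lattice (a discrete subgroup spanning $\mathbb{C}^2$ over $\mathbb{R}$), let $T=\mathbb{C}^2/\Lambda$ be the corresponding complex $2$-torus, let $n>0$, let $S\subset T$ be a set of $n$ distinct points, and let $\pi\colon X\to T$ be the blow-up of $T$ at the points of $S$, with exceptional curves $E_s=\pi^{-1}(s)$, $s\in S$. Let $\operatorname{Aut}(X)$ and $\operatorname{Aut}(T)$ denote the groups of biholomorphic self-maps of the complex surfaces $X$ and $T$ (translations of $T$ included), and let $\operatorname{Aut}(\Lambda)$ denote the group of automorphisms of the abelian group $\Lambda$. Then $\operatorname{Aut}(X)$, with the compact-open topology, is discrete. Moreover, there are group homomorphisms $d\colon\operatorname{Aut}(X)\to\operatorname{Aut}(T)$ and $\rho\colon\operatorname{Aut}(X)\to\operatorname{Aut}(\Lambda)$ with the following properties. 1. $d$ is injective, and for every $A\in\operatorname{Aut}(X)$ we have $\pi\circ A=d(A)\circ\pi$, $d(A)(S)=S$, and $A(E_s)=E_{d(A)(s)}$ for all $s\in S$; that is, $A$ permutes the exceptional curves and descends to a biholomorphic self-map of $T$ that maps the finite set $S$ onto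 itself. 2. For every $A\in\operatorname{Aut}(X)$ there are a $\mathbb{C}$-linear automorphism $L$ of $\mathbb{C}^2$ with $L|_\Lambda=\rho(A)$ and a vector $a\in\mathbb{C}^2$ such that $d(A)([z])=[Lz+a]$ for all $z\in\mathbb{C}^2$. 3. The kernel of $\rho$ is finite, and for every $s\in S$ the restriction of $\rho$ to the subgroup $\{A\in\operatorname{Aut}(X): d(A)(s)=s\}$ is injective. In particular, if $n=1$, then $\rho$ embeds $\operatorname{Aut}(X)$ into $\operatorname{Aut}(\Lambda)$. -/

import Mathlib

open scoped Manifold Topology ContDiff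

noncomputable section

/-- The model space `ℂ²` of complex surfaces. -/
abbrev C2 : Type := ℂ × ℂ

/-! ## Complex tori of dimension two -/

/-- The complex torus `ℂ² / Λ`. -/
abbrev ComplexTorus (Λ : Submodule ℤ C2) : Type := C2 ⧸ Λ.toAddSubgroup

namespace ComplexTorus

theorem isLocalHomeomorph_mk (Λ : Submodule ℤ C2) [DiscreteTopology Λ] :
    IsLocalHomeomorph (QuotientAddGroup.mk : C2 → ComplexTorus Λ) :=
  (AddSubgroup.isAddQuotientCoveringMap_of_comm Λ.toAddSubgroup
    (isDiscrete_iff_discreteTopology.2 (inferInstanceAs (DiscreteTopology Λ)))).isCoveringMap.isLocalHomeomorph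

/-- The charts of `ℂ² / Λ` are the local inverses of the projection `ℂ² → ℂ² / Λ`. -/
instance instChartedSpace (Λ : Submodule ℤ C2) [DiscreteTopology Λ] :
    ChartedSpace C2 (ComplexTorus Λ) :=
  (isLocalHomeomorph_mk Λ).chartedSpace QuotientAddGroup.mk_surjective

theorem chart_symm_eq (Λ : Submodule ℤ C2) [DiscreteTopology Λ]
    (e : OpenPartialHomeomorph (ComplexTorus Λ) C2) (he : e ∈ atlas C2 (ComplexTorus Λ)) (z : C2) :
    e.symm z = QuotientAddGroup.mk z := by
  obtain ⟨q, rfl⟩ := he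
  simp [chartAt_self_eq]

instance instT1Space (Λ : Submodule ℤ C2) [DiscreteTopology Λ] : T1Space (ComplexTorus Λ) := by
  have : DiscreteTopology Λ.toAddSubgroup := inferInstanceAs (DiscreteTopology Λ)
  have : IsClosed (Λ.toAddSubgroup : Set C2) := AddSubgroup.isClosed_of_discrete
  infer_instance

instance instIsManifold (Λ : Submodule ℤ C2) [DiscreteTopology Λ] :
    IsManifold 𝓘(ℂ, C2) ω (ComplexTorus Λ) := by
  refine isManifold_of_contDiffOn _ _ _ fun e e' he he' => ?_
  simp only [modelWithCornersSelf_coe, modelWithCornersSelf_coe_symm, Function.id_comp,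
    Function.comp_id, Set.preimage_id, Set.range_id, Set.inter_univ]
  -- the transition map is locally a translation by an element of `Λ`
  have hdisc : DiscreteTopology Λ := inferInstance
  set f : C2 → C2 := ⇑(e.symm ≫ₕ e') with hf
  have hsub : ∀ z ∈ (e.symm ≫ₕ e').source, f z - z ∈ Λ := by
    intro z hz
    have h1 : e'.symm (f z) = e.symm z := by
      simp only [OpenPartialHomeomorph.trans_source, Set.mem_inter_iff, Set.mem_preimage] at hz
      simp only [hf, OpenPartialHomeomorph.coe_trans, Function.comp_apply]
      exact e'.left_inv hz.2
    rw [chart_symm_eq Λ e he, chart_symm_eq Λ e' he', QuotientAddGroup.eq] at h1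
    have := Λ.neg_mem h1
    simpa [sub_eq_add_neg, add_comm] using this
  intro z hz
  have hnhds : (e.symm ≫ₕ e').source ∈ 𝓝 z := (e.symm ≫ₕ e').open_source.mem_nhds hz
  have hcont : ContinuousAt (fun w => f w - w) z :=
    ((e.symm ≫ₕ e').continuousAt hz).sub continuousAt_id
  obtain ⟨U, hU, hUΛ⟩ : ∃ U ∈ 𝓝 (f z - z), ∀ w ∈ U, w ∈ Λ → w = f z - z := by
    have h2 : ({⟨f z - z, hsub z hz⟩} : Set Λ) ∈ 𝓝 (⟨f z - z, hsub z hz⟩ : Λ) :=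
      (isOpen_discrete _).mem_nhds rfl
    rw [nhds_subtype_eq_comap] at h2
    obtain ⟨U, hU, h3⟩ := h2
    exact ⟨U, hU, fun w hw hwΛ => congrArg Subtype.val
      (show (⟨w, hwΛ⟩ : Λ) = ⟨f z - z, hsub z hz⟩ from h3 hw)⟩
  have heq : f =ᶠ[𝓝 z] fun w => w + (f z - z) := by
    filter_upwards [hnhds, hcont.preimage_mem_nhds hU] with w hw hwU
    have : f w - w = f z - z := hUΛ _ hwU (hsub w hw)
    rw [← this, add_sub_cancel]
  exact ((contDiffAt_id.add contDiffAt_const).congr_of_eventuallyEq heq).contDiffWithinAt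

end ComplexTorus

/-! ## Blowing up a complex surface at finitely many points -/

/-- The underlying set of the blow-up of the complex surface `M` at the points of `S`: the points
of `M` outside `S`, together with one projective line for each `s ∈ S`. The latter is the projective
line of the tangent space of `M` at `s`, which the preferred chart at `s` identifies with `ℂ²`. -/
inductive Blowup (M : Type*) (S : Finset M) : Type _
  | off (p : M) (hp : p ∉ S) : Blowup M S
  | exc (s : M) (hs : s ∈ S) (l : Projectivization ℂ C2) : Blowup M S

namespace Blowup

/-- The blow-down map. -/
def proj {M : Type*} {S : Finset M} : Blowup M S → M
  | off p _ => p
  | exc s _ _ => s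

/-- The exceptional curve over the point `s`. -/
def exceptionalCurve {M : Type*} (S : Finset M) (s : M) : Set (Blowup M S) := proj ⁻¹' {s}

theorem one_prod_ne_zero (g : C2 ≃L[ℂ] C2) (b : ℂ) : g (1, b) ≠ 0 := by
  simp [Prod.ext_iff]

open Classical in
/-- A set-theoretic section of the blow-down map (its values on `S` are irrelevant). -/
def lift {M : Type*} {S : Finset M} (p : M) : Blowup M S :=
  if h : p ∈ S then exc p h (Projectivization.mk ℂ ((1, 0) : C2) (by simp)) else off p h

theorem lift_of_notMem {M : Type*} {S : Finset M} {p : M} (h : p ∉ S) :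
    (lift p : Blowup M S) = off p h := by simp [lift, h]

/-- A chart of `M`, regarded as a chart of the blow-up away from the exceptional curves. -/
def chartOff {M : Type*} [TopologicalSpace M] (S : Finset M) (e : OpenPartialHomeomorph M C2) :
    PartialEquiv (Blowup M S) C2 where
  toFun x := e x.proj
  invFun z := lift (e.symm z)
  source := {x | x.proj ∈ e.source ∧ x.proj ∉ S}
  target := {z | z ∈ e.target ∧ e.symm z ∉ S}
  map_source' := by
    rintro x ⟨h1, h2⟩
    exact ⟨e.map_source h1, by rwa [e.left_inv h1]⟩
  map_target' := by
    rintro z ⟨h1, h2⟩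
    rw [lift_of_notMem h2]
    exact ⟨e.map_target h1, h2⟩
  left_inv' := by
    rintro (⟨p, hp⟩ | ⟨s, hs, l⟩) ⟨h1, h2⟩
    · simp only [proj] at h1 ⊢
      rw [e.left_inv h1, lift_of_notMem hp]
    · exact absurd hs h2
  right_inv' := by
    rintro z ⟨h1, h2⟩
    rw [lift_of_notMem h2]
    exact e.right_inv h1

/-- The coordinate `b` of a nonzero vector `g (a, a b)`; it depends only on the line it spans. -/
def slope (g : C2 ≃L[ℂ] C2) (v : C2) : ℂ := (g.symm v).2 / (g.symm v).1

theorem chartExc_aux (g : C2 ≃L[ℂ] C2) (v : C2) (h : (g.symm v).1 ≠ 0) :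
    g ((g.symm v).1, (g.symm v).1 * slope g v) = v := by
  rw [slope, mul_div_cancel₀ _ h]
  exact g.apply_symm_apply v

theorem slope_smul (g : C2 ≃L[ℂ] C2) (c : ℂ) (hc : c ≠ 0) (v : C2) :
    slope g (c • v) = slope g v := by
  simp only [slope, map_smul, Prod.smul_fst, Prod.smul_snd, smul_eq_mul]
  exact mul_div_mul_left _ _ hc

theorem mk_rep_fst_ne_zero (g : C2 ≃L[ℂ] C2) (b : ℂ) :
    (g.symm (Projectivization.mk ℂ (g (1, b)) (one_prod_ne_zero g b)).rep).1 ≠ 0 := by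
  obtain ⟨c, hc⟩ := Projectivization.exists_smul_eq_mk_rep ℂ (g (1, b)) (one_prod_ne_zero g b)
  rw [← hc, Units.smul_def, map_smul, g.symm_apply_apply]
  simp

theorem slope_mk_rep (g : C2 ≃L[ℂ] C2) (b : ℂ) :
    slope g (Projectivization.mk ℂ (g (1, b)) (one_prod_ne_zero g b)).rep = b := by
  obtain ⟨c, hc⟩ := Projectivization.exists_smul_eq_mk_rep ℂ (g (1, b)) (one_prod_ne_zero g b)
  rw [← hc, Units.smul_def, slope_smul _ _ c.ne_zero, slope, g.symm_apply_apply]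
  simp

theorem mk_slope_rep (g : C2 ≃L[ℂ] C2) (l : Projectivization ℂ C2) (h : (g.symm l.rep).1 ≠ 0) :
    Projectivization.mk ℂ (g (1, slope g l.rep)) (one_prod_ne_zero g _) = l := by
  conv_rhs => rw [← l.mk_rep]
  rw [Projectivization.mk_eq_mk_iff']
  refine ⟨(g.symm l.rep).1⁻¹, ?_⟩
  conv_lhs => rw [← chartExc_aux g l.rep h]
  rw [← map_smul]
  congr 1
  ext <;> simp [h]

theorem notMem_of_target {M : Type*} [TopologicalSpace M] [ChartedSpace C2 M] (S : Finset M) (s : M)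
    (g : C2 ≃L[ℂ] C2) {a b : ℂ} (ha : a ≠ 0)
    (h1 : chartAt C2 s s + g (a, a * b) ∈ (chartAt C2 s).target)
    (h2 : (chartAt C2 s).symm (chartAt C2 s s + g (a, a * b)) ∉ (S : Set M) \ {s}) :
    (chartAt C2 s).symm (chartAt C2 s s + g (a, a * b)) ∉ S := by
  intro h
  refine h2 ⟨h, fun hs' => ha ?_⟩
  have h3 := congrArg (chartAt C2 s) (Set.mem_singleton_iff.1 hs')
  rw [OpenPartialHomeomorph.right_inv _ h1, add_eq_left, g.map_eq_zero_iff] at h3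
  exact congrArg Prod.fst h3

open Classical in
/-- The chart `(a, b)` of the blow-up near the exceptional curve over `s`, with respect to a linear
coordinate system `g` of `ℂ²`. In the coordinates of `M` given by the preferred chart at `s`, centred
at `s`, the blow-down map is `(a, b) ↦ g (a, a b)`, and the point `(0, b)` is the line spanned by
`g (1, b)`. For `g` the identity and the exchange of the coordinates these are the two usual charts
`(a, b) ↦ (a, a b)` and `(a, b) ↦ (a b, a)`. -/
def chartExc {M : Type*} [TopologicalSpace M] [ChartedSpace C2 M] (S : Finset M) (s : M)
    (hs : s ∈ S) (g : C2 ≃L[ℂ] C2) : PartialEquiv (Blowup M S) C2 where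
  toFun x := match x with
    | off p _ => ((g.symm (chartAt C2 s p - chartAt C2 s s)).1, slope g (chartAt C2 s p - chartAt C2 s s))
    | exc _ _ l => (0, slope g l.rep)
  invFun z :=
    if z.1 = 0 then exc s hs (Projectivization.mk ℂ (g (1, z.2)) (one_prod_ne_zero g z.2))
    else lift ((chartAt C2 s).symm (chartAt C2 s s + g (z.1, z.1 * z.2)))
  source := {x | match x with
    | off p _ => p ∈ (chartAt C2 s).source ∧ (g.symm (chartAt C2 s p - chartAt C2 s s)).1 ≠ 0
    | exc t _ l => t = s ∧ (g.symm l.rep).1 ≠ 0}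
  target := {z | chartAt C2 s s + g (z.1, z.1 * z.2) ∈ (chartAt C2 s).target ∧
    (chartAt C2 s).symm (chartAt C2 s s + g (z.1, z.1 * z.2)) ∉ (S : Set M) \ {s}}
  map_source' := by
    rintro (⟨p, hp⟩ | ⟨t, ht, l⟩) hx
    · obtain ⟨h1, h2⟩ := hx
      have h3 := chartExc_aux g _ h2
      simp only [Set.mem_ofPred_eq, h3, add_sub_cancel, OpenPartialHomeomorph.left_inv _ h1]
      exact ⟨(chartAt C2 s).map_source h1, fun h => hp h.1⟩
    · simp only [Set.mem_ofPred_eq, zero_mul]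
      rw [show ((0, 0) : C2) = 0 from rfl, map_zero, add_zero,
        OpenPartialHomeomorph.left_inv _ (mem_chart_source C2 s)]
      exact ⟨mem_chart_target C2 s, fun h => h.2 rfl⟩
  map_target' := by
    rintro ⟨a, b⟩ ⟨h1, h2⟩
    by_cases ha : a = 0
    · simp only [ha, if_true, Set.mem_ofPred_eq, true_and]
      exact mk_rep_fst_ne_zero g b
    · have h3 := notMem_of_target S s g ha h1 h2
      simp only [ha, if_false, lift_of_notMem h3, Set.mem_ofPred_eq,
        OpenPartialHomeomorph.right_inv _ h1]
      exact ⟨(chartAt C2 s).map_target h1, by simpa using ha⟩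
  left_inv' := by
    rintro (⟨p, hp⟩ | ⟨t, ht, l⟩) hx
    · obtain ⟨h1, h2⟩ := hx
      have h3 := chartExc_aux g _ h2
      simp only [h2, if_false, h3, add_sub_cancel, OpenPartialHomeomorph.left_inv _ h1,
        lift_of_notMem hp]
    · obtain ⟨rfl, h2⟩ := hx
      simp only [if_true, mk_slope_rep g l h2]
  right_inv' := by
    rintro ⟨a, b⟩ ⟨h1, h2⟩
    by_cases ha : a = 0
    · simp only [ha, if_true, slope_mk_rep]
    · have h3 := notMem_of_target S s g ha h1 h2
      simp only [ha, if_false, lift_of_notMem h3, OpenPartialHomeomorph.right_inv _ h1, slope,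
        add_sub_cancel_left, ContinuousLinearEquiv.symm_apply_apply]
      simp [ha]

/-- The charts of the blow-up: those of `M` away from the exceptional curves, and the charts
`(a, b)` near the exceptional curves. -/
def charts (M : Type*) [TopologicalSpace M] [ChartedSpace C2 M] (S : Finset M) :
    Set (PartialEquiv (Blowup M S) C2) :=
  {c | (∃ e ∈ atlas C2 M, c = chartOff S e) ∨ ∃ (s : M) (hs : s ∈ S) (g : C2 ≃L[ℂ] C2),
    c = chartExc S s hs g}

section transition

variable {M : Type*} [TopologicalSpace M] [ChartedSpace C2 M] {S : Finset M}

theorem exists_param [IsManifold 𝓘(ℂ, C2) ω M] [T1Space M] {c : PartialEquiv (Blowup M S) C2}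
    (hc : c ∈ charts M S) {z : C2}
    (hz : z ∈ c.target) {p : M} {hp : p ∉ S} (hcz : c.symm z = off p hp) :
    ∃ σ : C2 → M, ContMDiffAt 𝓘(ℂ, C2) 𝓘(ℂ, C2) ω σ z ∧ σ z = p ∧
      ∀ᶠ w in 𝓝 z, w ∈ c.target ∧ ∃ h : σ w ∉ S, c.symm w = off (σ w) h := by
  have hSo : IsOpen {p : M | p ∉ S} := S.finite_toSet.isClosed.isOpen_compl
  obtain ⟨e, he, rfl⟩ | ⟨s, hs, g, rfl⟩ := hc
  · have hz' : z ∈ e.target ∧ e.symm z ∉ S := hz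
    have hσ := (contMDiffOn_symm_of_mem_maximalAtlas (I := 𝓘(ℂ, C2)) (n := ω)
      (IsManifold.subset_maximalAtlas he)).contMDiffAt (e.open_target.mem_nhds hz'.1)
    refine ⟨e.symm, hσ, ?_, ?_⟩
    · change lift (e.symm z) = _ at hcz
      rw [lift_of_notMem hz'.2] at hcz
      exact (off.inj hcz)
    · filter_upwards [e.open_target.mem_nhds hz'.1,
        hσ.continuousAt.preimage_mem_nhds (hSo.mem_nhds hz'.2)] with w h1 h2
      exact ⟨⟨h1, h2⟩, h2, lift_of_notMem h2⟩
  · have hz' : chartAt C2 s s + g (z.1, z.1 * z.2) ∈ (chartAt C2 s).target ∧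
      (chartAt C2 s).symm (chartAt C2 s s + g (z.1, z.1 * z.2)) ∉ (S : Set M) \ {s} := hz
    have hz0 : z.1 ≠ 0 := by
      intro h
      change ite _ _ _ = _ at hcz
      rw [if_pos h] at hcz
      cases hcz
    have hzS := notMem_of_target S s g hz0 hz'.1 hz'.2
    have hlin : ContDiff ℂ ω fun w : C2 => chartAt C2 s s + g (w.1, w.1 * w.2) := by fun_prop
    have hσ : ContMDiffAt 𝓘(ℂ, C2) 𝓘(ℂ, C2) ω
        (fun w : C2 => (chartAt C2 s).symm (chartAt C2 s s + g (w.1, w.1 * w.2))) z :=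
      ((contMDiffOn_symm_of_mem_maximalAtlas (I := 𝓘(ℂ, C2)) (n := ω)
        (IsManifold.chart_mem_maximalAtlas s)).contMDiffAt
        ((chartAt C2 s).open_target.mem_nhds hz'.1)).comp z hlin.contMDiff.contMDiffAt
    refine ⟨_, hσ, ?_, ?_⟩
    · change ite _ _ _ = _ at hcz
      rw [if_neg hz0, lift_of_notMem hzS] at hcz
      exact off.inj hcz
    · filter_upwards [hlin.continuous.continuousAt.preimage_mem_nhds
        ((chartAt C2 s).open_target.mem_nhds hz'.1),
        hσ.continuousAt.preimage_mem_nhds (hSo.mem_nhds hzS),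
        (isOpen_ne.preimage continuous_fst).mem_nhds hz0] with w h1 h2 h3
      refine ⟨⟨h1, fun h => h2 h.1⟩, h2, ?_⟩
      change ite _ _ _ = _
      rw [if_neg h3, lift_of_notMem h2]

theorem exists_coord [IsManifold 𝓘(ℂ, C2) ω M] {c : PartialEquiv (Blowup M S) C2}
    (hc : c ∈ charts M S) {p : M} {hp : p ∉ S} (hcp : off p hp ∈ c.source) :
    ∃ τ : M → C2, ContMDiffAt 𝓘(ℂ, C2) 𝓘(ℂ, C2) ω τ p ∧
      ∀ᶠ q in 𝓝 p, ∀ h : q ∉ S, off q h ∈ c.source ∧ c (off q h) = τ q := by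
  obtain ⟨e, he, rfl⟩ | ⟨s, hs, g, rfl⟩ := hc
  · have hp' : p ∈ e.source ∧ p ∉ S := hcp
    refine ⟨e, (contMDiffOn_of_mem_maximalAtlas (I := 𝓘(ℂ, C2)) (n := ω)
      (IsManifold.subset_maximalAtlas he)).contMDiffAt (e.open_source.mem_nhds hp'.1), ?_⟩
    filter_upwards [e.open_source.mem_nhds hp'.1] with q hq h
    exact ⟨⟨hq, h⟩, rfl⟩
  · have hp' : p ∈ (chartAt C2 s).source ∧ (g.symm (chartAt C2 s p - chartAt C2 s s)).1 ≠ 0 := hcp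
    have he : ContMDiffAt 𝓘(ℂ, C2) 𝓘(ℂ, C2) ω (chartAt C2 s) p :=
      (contMDiffOn_of_mem_maximalAtlas (I := 𝓘(ℂ, C2)) (n := ω)
        (IsManifold.chart_mem_maximalAtlas s)).contMDiffAt
        ((chartAt C2 s).open_source.mem_nhds hp'.1)
    have hlin : ContDiff ℂ ω fun v : C2 => g.symm (v - chartAt C2 s s) := by fun_prop
    have hφ : ContDiffAt ℂ ω (fun v : C2 => (((g.symm (v - chartAt C2 s s)).1,
        slope g (v - chartAt C2 s s)) : C2)) (chartAt C2 s p) :=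
      hlin.fst.contDiffAt.prodMk (hlin.snd.contDiffAt.div hlin.fst.contDiffAt hp'.2)
    refine ⟨_, hφ.contMDiffAt.comp p he, ?_⟩
    filter_upwards [(chartAt C2 s).open_source.mem_nhds hp'.1,
      (hlin.continuous.fst.continuousAt.comp he.continuousAt).preimage_mem_nhds
        (isOpen_ne.mem_nhds hp'.2)] with q h1 h2 h
    exact ⟨⟨h1, h2⟩, rfl⟩

theorem transition [IsManifold 𝓘(ℂ, C2) ω M] [T1Space M] {c d : PartialEquiv (Blowup M S) C2}
    (hc : c ∈ charts M S) (hd : d ∈ charts M S) {z : C2} (hz : z ∈ (c.symm.trans d).source) :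
    (c.symm.trans d).source ∈ 𝓝 z ∧ ContDiffAt ℂ ω (c.symm.trans d) z := by
  have hz1 : z ∈ c.target := hz.1
  have hz2 : c.symm z ∈ d.source := hz.2
  generalize hx : c.symm z = x at hz2
  rcases x with ⟨p, hp⟩ | ⟨s, hs, l⟩
  · obtain ⟨σ, hσ, rfl, hσ'⟩ := exists_param hc hz1 hx
    obtain ⟨τ, hτ, hτ'⟩ := exists_coord hd hz2
    have hev : ∀ᶠ w in 𝓝 z, w ∈ (c.symm.trans d).source ∧ c.symm.trans d w = τ (σ w) := by
      filter_upwards [hσ', hσ.continuousAt.eventually hτ'] with w ⟨h1, h2, h3⟩ h4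
      obtain ⟨h5, h6⟩ := h4 h2
      refine ⟨⟨h1, ?_⟩, ?_⟩
      · change c.symm w ∈ d.source
        rwa [h3]
      · change d (c.symm w) = _
        rw [h3, h6]
    exact ⟨hev.mono fun w h => h.1, (hτ.comp z hσ).contDiffAt.congr_of_eventuallyEq
      (hev.mono fun w h => h.2)⟩
  · obtain ⟨e, he, rfl⟩ | ⟨t, ht, g, rfl⟩ := hc
    · have : e.symm z ∉ S := hz1.2
      change lift (e.symm z) = _ at hx
      rw [lift_of_notMem this] at hx
      cases hx
    obtain ⟨e, he, rfl⟩ | ⟨t', ht', g', rfl⟩ := hd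
    · exact absurd hs hz2.2
    obtain ⟨rfl, hl⟩ : s = t' ∧ (g'.symm l.rep).1 ≠ 0 := hz2
    have hz0 : z.1 = 0 := by
      by_contra h
      change ite _ _ _ = _ at hx
      rw [if_neg h, lift_of_notMem (notMem_of_target S t g h hz1.1 hz1.2)] at hx
      cases hx
    change ite _ _ _ = _ at hx
    rw [if_pos hz0] at hx
    obtain ⟨rfl, hl'⟩ := exc.inj hx
    have hsmul : ∀ a b : ℂ, g (a, a * b) = a • g (1, b) := fun a b => by
      rw [← map_smul]; simp
    -- the first coordinate of the line through `g (1, b)` in the new linear coordinates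
    have hrep : ∀ b : ℂ, (g'.symm (Projectivization.mk ℂ (g (1, b))
        (one_prod_ne_zero g b)).rep).1 ≠ 0 ↔ (g'.symm (g (1, b))).1 ≠ 0 := fun b => by
      obtain ⟨u, hu⟩ := Projectivization.exists_smul_eq_mk_rep ℂ (g (1, b)) (one_prod_ne_zero g b)
      rw [← hu, Units.smul_def, map_smul]
      simp
    have hslope : ∀ b : ℂ, slope g' (Projectivization.mk ℂ (g (1, b))
        (one_prod_ne_zero g b)).rep = slope g' (g (1, b)) := fun b => by
      obtain ⟨u, hu⟩ := Projectivization.exists_smul_eq_mk_rep ℂ (g (1, b)) (one_prod_ne_zero g b)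
      rw [← hu, Units.smul_def, slope_smul _ _ u.ne_zero]
    have hpz : (g'.symm (g (1, z.2))).1 ≠ 0 := by
      rw [← hrep, hl']; exact hl
    have hlin : ContDiff ℂ ω fun w : C2 => g'.symm (g (1, w.2)) := by fun_prop
    have hcont : Continuous fun w : C2 => chartAt C2 t t + g (w.1, w.1 * w.2) := by fun_prop
    have hz1' : chartAt C2 t t + g (z.1, z.1 * z.2) ∈ (chartAt C2 t).target ∧
      (chartAt C2 t).symm (chartAt C2 t t + g (z.1, z.1 * z.2)) ∉ (S : Set M) \ {t} := hz1
    have htarget : ∀ᶠ w in 𝓝 z, w ∈ (chartExc S t ht g).target := by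
      have hopen : IsOpen ((S : Set M) \ {t})ᶜ := (S.finite_toSet.sdiff).isClosed.isOpen_compl
      have h1 := (chartAt C2 t).open_target.mem_nhds hz1'.1
      have h2 := ((chartAt C2 t).continuousAt_symm hz1'.1).preimage_mem_nhds
        (hopen.mem_nhds hz1'.2)
      filter_upwards [hcont.continuousAt.preimage_mem_nhds h1,
        hcont.continuousAt.preimage_mem_nhds h2] with w h3 h4
      exact ⟨h3, h4⟩
    have hev : ∀ᶠ w in 𝓝 z, w ∈ ((chartExc S t ht g).symm.trans (chartExc S t ht' g')).source ∧
        (chartExc S t ht g).symm.trans (chartExc S t ht' g') w =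
          (w.1 * (g'.symm (g (1, w.2))).1, slope g' (g (1, w.2))) := by
      filter_upwards [htarget,
        hlin.continuous.fst.continuousAt.preimage_mem_nhds (isOpen_ne.mem_nhds hpz)] with w h1 h2
      have h2' : (g'.symm (g (1, w.2))).1 ≠ 0 := h2
      by_cases hw : w.1 = 0
      · have h3 : (chartExc S t ht g).symm w = exc t ht (Projectivization.mk ℂ (g (1, w.2))
            (one_prod_ne_zero g w.2)) := if_pos hw
        refine ⟨⟨h1, ?_⟩, ?_⟩
        · change (chartExc S t ht g).symm w ∈ (chartExc S t ht' g').source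
          rw [h3]
          exact ⟨rfl, (hrep _).2 h2'⟩
        · change chartExc S t ht' g' ((chartExc S t ht g).symm w) = _
          rw [h3, hw, zero_mul]
          exact Prod.ext rfl (hslope _)
      · have h3 : (chartExc S t ht g).symm w =
            off _ (notMem_of_target S _ g hw h1.1 h1.2) :=
          (if_neg hw).trans (lift_of_notMem _)
        have h4 := (chartAt C2 t).right_inv h1.1
        have h5 : (g'.symm (w.1 • g (1, w.2))).1 = w.1 * (g'.symm (g (1, w.2))).1 := by
          rw [map_smul]; rfl
        refine ⟨⟨h1, ?_⟩, ?_⟩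
        · change (chartExc S t ht g).symm w ∈ (chartExc S t ht' g').source
          rw [h3]
          refine ⟨(chartAt C2 t).map_target h1.1, ?_⟩
          rw [h4, add_sub_cancel_left, hsmul, h5]
          exact mul_ne_zero hw h2'
        · change chartExc S t ht' g' ((chartExc S t ht g).symm w) = _
          rw [h3]
          refine Prod.ext ?_ ?_
          · change (g'.symm (_ - _)).1 = _
            rw [h4, add_sub_cancel_left, hsmul, h5]
          · change slope g' (_ - _) = _
            rw [h4, add_sub_cancel_left, hsmul, slope_smul _ _ hw]
    refine ⟨hev.mono fun w h => h.1, ContDiffAt.congr_of_eventuallyEq ?_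
      (hev.mono fun w h => h.2)⟩
    exact ((contDiff_fst.mul hlin.fst).contDiffAt).prodMk
      (hlin.snd.contDiffAt.div hlin.fst.contDiffAt hpz)

end transition

open Classical in
/-- Linear coordinates of `ℂ²` in which the line `l` has finite slope: the identity or the exchange
of the two coordinates. -/
def lineCoord (l : Projectivization ℂ C2) : C2 ≃L[ℂ] C2 :=
  if l.rep.1 ≠ 0 then .refl ℂ C2 else .prodComm ℂ ℂ ℂ

theorem lineCoord_spec (l : Projectivization ℂ C2) : ((lineCoord l).symm l.rep).1 ≠ 0 := by
  by_cases h : l.rep.1 = 0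
  · have : l.rep.2 ≠ 0 := fun h' => l.rep_nonzero (Prod.ext h h')
    simp [lineCoord, h, this]
  · simp [lineCoord, h]

section manifold

variable (M : Type*) [TopologicalSpace M] [T1Space M] [ChartedSpace C2 M]
  [IsManifold 𝓘(ℂ, C2) ω M] (S : Finset M)

/-- The atlas of the blow-up. -/
def chartedSpaceCore : ChartedSpaceCore C2 (Blowup M S) where
  atlas := charts M S
  chartAt
    | off p _ => chartOff S (chartAt C2 p)
    | exc s hs l => chartExc S s hs (lineCoord l)
  mem_chart_source := by
    rintro (⟨p, hp⟩ | ⟨s, hs, l⟩)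
    · exact ⟨mem_chart_source C2 p, hp⟩
    · exact ⟨rfl, lineCoord_spec l⟩
  chart_mem_atlas := by
    rintro (⟨p, hp⟩ | ⟨s, hs, l⟩)
    · exact Or.inl ⟨_, chart_mem_atlas C2 p, rfl⟩
    · exact Or.inr ⟨s, hs, _, rfl⟩
  open_source _ _ hc hd := isOpen_iff_mem_nhds.2 fun _ hz => (transition hc hd hz).1
  continuousOn_toFun _ _ hc hd := fun _ hz =>
    (transition hc hd hz).2.continuousAt.continuousWithinAt

instance instTopologicalSpace : TopologicalSpace (Blowup M S) :=
  (chartedSpaceCore M S).toTopologicalSpace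

instance instChartedSpace : ChartedSpace C2 (Blowup M S) :=
  (chartedSpaceCore M S).toChartedSpace

instance instIsManifold : IsManifold 𝓘(ℂ, C2) ω (Blowup M S) := by
  refine isManifold_of_contDiffOn _ _ _ fun e e' he he' => ?_
  obtain ⟨_, ⟨c, rfl⟩, _, ⟨hc, rfl⟩, rfl⟩ := he
  obtain ⟨_, ⟨d, rfl⟩, _, ⟨hd, rfl⟩, rfl⟩ := he'
  intro z hz
  have hz' : z ∈ (c.symm.trans d).source := hz.1
  exact (transition hc hd hz').2.contDiffWithinAt

end manifold

end Blowup

/-! ## The group of holomorphic automorphisms -/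

/-- The biholomorphic self-maps of a complex surface `X`. (Over `ℂ`, the smoothness exponent `ω`
means holomorphic.) -/
def HolAut (X : Type*) [TopologicalSpace X] [ChartedSpace C2 X] : Type _ :=
  X ≃ₘ^ω⟮𝓘(ℂ, C2), 𝓘(ℂ, C2)⟯ X

namespace HolAut

variable {X : Type*} [TopologicalSpace X] [ChartedSpace C2 X]

instance instEquivLike : EquivLike (HolAut X) X X :=
  inferInstanceAs (EquivLike (X ≃ₘ^ω⟮𝓘(ℂ, C2), 𝓘(ℂ, C2)⟯ X) X X)

theorem contMDiff (A : HolAut X) : ContMDiff 𝓘(ℂ, C2) 𝓘(ℂ, C2) ω A :=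
  Diffeomorph.contMDiff A

/-- The group law is composition. -/
instance instGroup : Group (HolAut X) where
  mul A B := Diffeomorph.trans B A
  one := Diffeomorph.refl _ X _
  inv A := Diffeomorph.symm A
  mul_assoc _ _ _ := DFunLike.ext _ _ fun _ => rfl
  one_mul _ := DFunLike.ext _ _ fun _ => rfl
  mul_one _ := DFunLike.ext _ _ fun _ => rfl
  inv_mul_cancel A := DFunLike.ext _ _ fun x => Diffeomorph.symm_apply_apply A x

theorem mul_apply (A B : HolAut X) (x : X) : (A * B) x = A (B x) := rfl

/-- The compact-open topology. -/
instance instTopologicalSpace : TopologicalSpace (HolAut X) :=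
  TopologicalSpace.induced (fun A => (⟨A, A.contMDiff.continuous⟩ : C(X, X)))
    ContinuousMap.compactOpen

end HolAut

end

noncomputable section

/-! ## Maps into and between complex tori -/

namespace ComplexTorus

/-! A holomorphic map from the Riemann sphere to a torus lifts to a bounded entire map, so it is
constant. Hence `proj ∘ A` contracts every exceptional curve (`apply_exc_eq`). As `proj` is a
quotient map, `A` descends to a continuous map of the torus, holomorphic off `S`.

Such a map lifts to a continuous `H` on `ℂ²`. On each complex line `H` has only isolated possible
singularities, and these are removable. The increments `z ↦ H (z + w) - H z` are `Λ`-periodic, hence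
bounded, and Liouville makes `H` affine (`ComplexTorus.exists_affine`). In particular the descent is
holomorphic at `S` too, and it preserves `S` because `A` cannot squeeze a curve into a point.

The descent determines `A`, since the complement of the exceptional curves is dense. The linear part
is determined on `Λ`, which spans `ℂ²` over `ℝ`. Descents with equal linear parts differ by a
translation, so they agree once they agree at one `s ∈ S`, whose image lies in the finite set `S`.
This gives the finite kernel and the injectivity on stabilizers.

For discreteness, linear parts send finitely many generators of `Λ` into `Λ`, so descents that are
close on a small ball have equal linear parts (`exists_pos_linear_eq`). Nearby automorphisms also
send `s` to the same point of `S`. -/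

/-- The projection `ℂ² → ℂ² / Λ`. -/
abbrev mk (Λ : Submodule ℤ C2) : C2 → ComplexTorus Λ := QuotientAddGroup.mk

theorem mk_eq_mk_iff {Λ : Submodule ℤ C2} {z w : C2} : mk Λ z = mk Λ w ↔ z - w ∈ Λ := by
  rw [eq_comm, QuotientAddGroup.eq, neg_add_eq_sub]
  rfl

theorem mk_surjective (Λ : Submodule ℤ C2) : Function.Surjective (mk Λ) :=
  QuotientAddGroup.mk_surjective

/-- Since `v` and `0` have the same class, comparing the affine formula at both gives the claim. -/
theorem linear_mem {Λ : Submodule ℤ C2} {f : ComplexTorus Λ → ComplexTorus Λ} {L : C2 →L[ℂ] C2} {a : C2}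
    (h : ∀ z, f (mk Λ z) = mk Λ (L z + a)) {v : C2} (hv : v ∈ Λ) : L v ∈ Λ := by
  have h1 := (h v).symm.trans ((congrArg f (mk_eq_mk_iff.2 (by simpa using hv))).trans (h 0))
  simpa [mk_eq_mk_iff] using h1

variable {Λ : Submodule ℤ C2} [DiscreteTopology Λ]

instance instT2Space : T2Space (ComplexTorus Λ) := inferInstance

theorem isCoveringMap_mk : IsCoveringMap (mk Λ) :=
  (AddSubgroup.isAddQuotientCoveringMap_of_comm Λ.toAddSubgroup
    (isDiscrete_iff_discreteTopology.2 (inferInstanceAs (DiscreteTopology Λ)))).isCoveringMap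

theorem continuous_mk : Continuous (mk Λ) := isCoveringMap_mk.continuous

/-- A map that is continuous at a point and takes values in the lattice is locally constant. -/
theorem eventually_eq_of_mem {E : Type*} [TopologicalSpace E] {f : E → C2} {z : E}
    (hf : ContinuousAt f z) (hfΛ : ∀ᶠ w in 𝓝 z, f w ∈ Λ) : ∀ᶠ w in 𝓝 z, f w = f z := by
  have hz : f z ∈ Λ := hfΛ.self_of_nhds
  have h2 : ({⟨f z, hz⟩} : Set Λ) ∈ 𝓝 (⟨f z, hz⟩ : Λ) := (isOpen_discrete _).mem_nhds rfl
  rw [nhds_subtype_eq_comap] at h2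
  obtain ⟨U, hU, h3⟩ := h2
  filter_upwards [hfΛ, hf.preimage_mem_nhds hU] with w hw hwU
  exact congrArg Subtype.val (show (⟨f w, hw⟩ : Λ) = ⟨f z, hz⟩ from h3 hwU)

/-- A continuous map from a connected set to the lattice is constant. -/
theorem eq_of_mem {E : Type*} [TopologicalSpace E] {U : Set E} (hU : IsPreconnected U) {f : E → C2}
    (hf : ContinuousOn f U) (hfΛ : ∀ w ∈ U, f w ∈ Λ) {x y : E} (hx : x ∈ U) (hy : y ∈ U) :
    f x = f y :=
  hU.constant_of_mapsTo (T := (Λ : Set C2))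
    (isDiscrete_iff_discreteTopology.2 (inferInstanceAs (DiscreteTopology Λ))) hf hfΛ hx hy

theorem contMDiff_mk : ContMDiff 𝓘(ℂ, C2) 𝓘(ℂ, C2) ω (mk Λ) := by
  intro z
  set e := chartAt C2 (mk Λ z) with he
  have hsymm : ∀ w, e.symm w = mk Λ w := chart_symm_eq Λ e (chart_mem_atlas C2 _)
  have hsrc : mk Λ z ∈ e.source := mem_chart_source C2 _
  set v := e (mk Λ z) with hv
  have hvz : z - v ∈ Λ := by
    rw [← mk_eq_mk_iff, ← hsymm v, hv, e.left_inv hsrc]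
  -- The chart may send the class of `z` to another representative `v`. Translation by the lattice
  -- vector `z - v` corrects this.
  have h1 : ContMDiffAt 𝓘(ℂ, C2) 𝓘(ℂ, C2) ω e.symm (z - (z - v)) := by
    rw [sub_sub_cancel]
    exact contMDiffAt_symm_of_mem_maximalAtlas (IsManifold.chart_mem_maximalAtlas _)
      (e.map_source hsrc)
  have h2 : ContMDiffAt 𝓘(ℂ, C2) 𝓘(ℂ, C2) ω (fun w : C2 => w - (z - v)) z :=
    (contDiff_id.sub contDiff_const).contMDiff.contMDiffAt
  refine (h1.comp z h2).congr_of_eventuallyEq (Filter.Eventually.of_forall fun w => ?_)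
  rw [Function.comp_apply, hsymm, mk_eq_mk_iff, sub_sub_cancel]
  exact hvz

/-- A continuous lift of a holomorphic map to the torus is holomorphic. -/
theorem contDiffAt_of_mk_comp {E : Type*} [NormedAddCommGroup E] [NormedSpace ℂ E] {G : E → C2}
    {z : E} (hG : ContinuousAt G z)
    (h : ContMDiffAt 𝓘(ℂ, E) 𝓘(ℂ, C2) ω (fun w => mk Λ (G w)) z) : ContDiffAt ℂ ω G z := by
  set e := chartAt C2 (mk Λ (G z)) with he
  have hsymm : ∀ w, e.symm w = mk Λ w := chart_symm_eq Λ e (chart_mem_atlas C2 _)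
  have hsrc : mk Λ (G z) ∈ e.source := mem_chart_source C2 _
  have h1 : ContMDiffAt 𝓘(ℂ, E) 𝓘(ℂ, C2) ω (fun w => e (mk Λ (G w))) z :=
    (contMDiffAt_of_mem_maximalAtlas (IsManifold.chart_mem_maximalAtlas _) hsrc).comp z h
  -- `G` and the chart coordinate lift the same map, so they differ by a lattice vector, which is
  -- locally constant.
  have h2 : ∀ᶠ w in 𝓝 z, G w - e (mk Λ (G w)) ∈ Λ := by
    filter_upwards [h.continuousAt.preimage_mem_nhds (e.open_source.mem_nhds hsrc)] with w hw
    rw [← mk_eq_mk_iff, ← hsymm (e _), e.left_inv hw]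
  have h3 := eventually_eq_of_mem (hG.sub h1.continuousAt) h2
  refine (h1.contDiffAt.add (contDiffAt_const (c := G z - e (mk Λ (G z))))).congr_of_eventuallyEq ?_
  filter_upwards [h3] with w hw
  have hw' : G w - e (mk Λ (G w)) = G z - e (mk Λ (G z)) := hw
  rw [← hw', add_sub_cancel]

theorem contMDiff_of_comp_mk {f : ComplexTorus Λ → ComplexTorus Λ}
    (h : ContMDiff 𝓘(ℂ, C2) 𝓘(ℂ, C2) ω (fun z => f (mk Λ z))) :
    ContMDiff 𝓘(ℂ, C2) 𝓘(ℂ, C2) ω f := by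
  intro p
  set e := chartAt C2 p with he
  have hsymm : ∀ w, e.symm w = mk Λ w := chart_symm_eq Λ e (chart_mem_atlas C2 _)
  have h1 : ContMDiffAt 𝓘(ℂ, C2) 𝓘(ℂ, C2) ω e p :=
    contMDiffAt_of_mem_maximalAtlas (IsManifold.chart_mem_maximalAtlas _) (mem_chart_source C2 _)
  refine ((h (e p)).comp p h1).congr_of_eventuallyEq ?_
  filter_upwards [e.open_source.mem_nhds (mem_chart_source C2 p)] with q hq
  rw [Function.comp_apply, ← hsymm, e.left_inv hq]

theorem exists_lift {A : Type*} [TopologicalSpace A] [SimplyConnectedSpace A]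
    [LocallyPathConnectedSpace A] {f : A → ComplexTorus Λ} (hf : Continuous f) :
    ∃ F : A → C2, Continuous F ∧ ∀ a, mk Λ (F a) = f a := by
  obtain ⟨a⟩ : Nonempty A := inferInstance
  obtain ⟨v, hv⟩ := mk_surjective Λ (f a)
  obtain ⟨F, ⟨-, hF⟩, -⟩ := isCoveringMap_mk.existsUnique_continuousMap_lifts ⟨f, hf⟩ a v hv
  exact ⟨F, F.continuous, congrFun hF⟩

/-- The points of a complex line in `ℂ²` lying over a finite subset of the torus are isolated. -/
theorem eventually_line_notMem (S : Finset (ComplexTorus Λ)) (p : C2) {v : C2} (hv : v ≠ 0)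
    (t₀ : ℂ) : ∀ᶠ t in 𝓝[≠] t₀, mk Λ (p + t • v) ∉ S := by
  have hline : Continuous fun t : ℂ => p + t • v := by fun_prop
  -- Two ways to meet `S` near `t₀` are excluded separately: at a different point of `S` by
  -- closedness of a finite set (`h1`), at the same point by discreteness of `Λ` (`h2`).
  have hopen : IsOpen ((S : Set (ComplexTorus Λ)) \ {mk Λ (p + t₀ • v)})ᶜ :=
    (S.finite_toSet.sdiff).isClosed.isOpen_compl
  have h1 : ∀ᶠ t in 𝓝 t₀, mk Λ (p + t • v) ∉ (S : Set (ComplexTorus Λ)) \ {mk Λ (p + t₀ • v)} :=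
    (continuous_mk.comp hline).continuousAt.preimage_mem_nhds
      (hopen.mem_nhds fun h => h.2 rfl)
  have h2 : ∀ᶠ t in 𝓝 t₀, (t - t₀) • v ∈ Λ → (t - t₀) • v = 0 := by
    have h3 : ({0} : Set Λ) ∈ 𝓝 (0 : Λ) := (isOpen_discrete _).mem_nhds rfl
    rw [nhds_subtype_eq_comap] at h3
    obtain ⟨U, hU, h4⟩ := h3
    have h5 : ContinuousAt (fun t : ℂ => (t - t₀) • v) t₀ := by fun_prop
    have h6 : U ∈ 𝓝 ((t₀ - t₀) • v) := by simpa using hU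
    filter_upwards [h5.preimage_mem_nhds h6] with t ht htΛ
    exact congrArg Subtype.val (show (⟨_, htΛ⟩ : Λ) = 0 from h4 ht)
  filter_upwards [h1.filter_mono nhdsWithin_le_nhds, h2.filter_mono nhdsWithin_le_nhds,
    self_mem_nhdsWithin] with t ht1 ht2 ht3 htS
  have h7 : mk Λ (p + t • v) = mk Λ (p + t₀ • v) := by
    by_contra h
    exact ht1 ⟨htS, h⟩
  rw [mk_eq_mk_iff, add_sub_add_left_eq_sub, ← sub_smul] at h7
  rcases smul_eq_zero.1 (ht2 h7) with h | h
  · exact ht3 (sub_eq_zero.1 h)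
  · exact hv h

/-! ### Affineness of torus maps -/

/-- A continuous additive map that is holomorphic along complex lines through the origin is
`ℂ`-linear. -/
theorem exists_continuousLinearMap {E F : Type*} [NormedAddCommGroup E] [NormedSpace ℂ E]
    [NormedAddCommGroup F] [NormedSpace ℂ F] {f : E → F} (hf : Continuous f)
    (hadd : ∀ x y, f (x + y) = f x + f y)
    (hline : ∀ v, DifferentiableAt ℂ (fun t : ℂ => f (t • v)) 0) :
    ∃ L : E →L[ℂ] F, ∀ v, L v = f v := by
  let f₁ : E →+ F := AddMonoidHom.mk' f hadd
  let fR : E →L[ℝ] F := f₁.toRealLinearMap hf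
  have hfR : ∀ v, fR v = f v := fun _ => rfl
  have hsmul : ∀ (c : ℂ) v, f (c • v) = c • f v := by
    intro c v
    -- A real-linear map is its own real derivative. Here the real derivative at `0` is also
    -- complex-linear, so by uniqueness `g` is complex-linear.
    let g : ℂ →L[ℝ] F := fR.comp ((ContinuousLinearMap.toSpanSingleton ℂ v).restrictScalars ℝ)
    have hg : ∀ t : ℂ, g t = f (t • v) := fun t => rfl
    have h1 : HasFDerivAt (𝕜 := ℝ) g g 0 := g.hasFDerivAt
    have h2 : HasFDerivAt (𝕜 := ℝ) g
        ((fderiv ℂ (fun t : ℂ => f (t • v)) 0).restrictScalars ℝ) 0 :=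
      (hline v).hasFDerivAt.restrictScalars ℝ
    have h3 := h1.unique h2
    have h4 : ∀ t : ℂ, f (t • v) = fderiv ℂ (fun t : ℂ => f (t • v)) 0 t := fun t => by
      rw [← hg]
      exact congrArg (fun l : ℂ →L[ℝ] F => l t) h3
    have h5 := h4 1
    rw [one_smul] at h5
    rw [h4 c, h5, ← map_smul, smul_eq_mul, mul_one]
  exact ⟨⟨{ toFun := f, map_add' := hadd, map_smul' := hsmul }, hf⟩, fun _ => rfl⟩

/-- A continuous self-map of the torus that is holomorphic outside a finite set is affine. -/
theorem exists_affine [IsZLattice ℝ Λ] {f : ComplexTorus Λ → ComplexTorus Λ} (hf : Continuous f)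
    (S : Finset (ComplexTorus Λ)) (hfS : ∀ p ∉ S, ContMDiffAt 𝓘(ℂ, C2) 𝓘(ℂ, C2) ω f p) :
    ∃ (L : C2 →L[ℂ] C2) (a : C2), ∀ z, f (mk Λ z) = mk Λ (L z + a) := by
  obtain ⟨H, hH, hHf⟩ := exists_lift (hf.comp continuous_mk)
  have hdiff : ∀ z, mk Λ z ∉ S → ContDiffAt ℂ ω H z := fun z hz => by
    refine contDiffAt_of_mk_comp (Λ := Λ) hH.continuousAt ?_
    simp only [hHf]
    exact (hfS _ hz).comp z (contMDiff_mk z)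
  -- Removable singularities in one variable suffice: the line meets the preimage of `S` in isolated
  -- points and `H` is continuous there.
  have hline : ∀ p v : C2, Differentiable ℂ fun t : ℂ => H (p + t • v) := by
    intro p v t₀
    have hc : Continuous fun t : ℂ => p + t • v := by fun_prop
    rcases eq_or_ne v 0 with rfl | hv
    · simp
    refine (Complex.analyticAt_of_differentiable_on_punctured_nhds_of_continuousAt ?_
      (hH.comp hc).continuousAt).differentiableAt
    filter_upwards [eventually_line_notMem S p hv t₀] with t ht
    exact ((hdiff _ ht).differentiableAt (by simp)).comp t (by fun_prop)
  have hper : ∀ w z v, v ∈ Λ → H (z + v + w) - H (z + v) = H (z + w) - H z := by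
    intro w z v hv
    -- The increment of `H` along a lattice vector is `Λ`-valued and continuous, hence independent
    -- of the base point.
    have h1 : H (z + w + v) - H (z + w) = H (z + v) - H z := by
      refine eq_of_mem (Λ := Λ) (f := fun z => H (z + v) - H z) isPreconnected_univ
        (by fun_prop) (fun x _ => ?_) (Set.mem_univ _) (Set.mem_univ _)
      rw [← mk_eq_mk_iff, hHf, hHf, Function.comp_apply, Function.comp_apply]
      congr 1
      rw [mk_eq_mk_iff, add_sub_cancel_left]
      exact hv
    rw [add_right_comm, sub_eq_sub_iff_add_eq_add, add_comm (H (z + w)), ← sub_eq_sub_iff_add_eq_add]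
    exact h1
  have hconst : ∀ w v, H (v + w) - H v = H w - H 0 := by
    intro w v
    have hb := (IsZLattice.isCompact_range_of_periodic Λ (fun z => H (z + w) - H z) (by fun_prop)
      (fun z v hv => hper w z v hv)).isBounded
    -- Liouville on the line spanned by `v`: the increment by `w` is bounded, so its values at `v`
    -- (`t = 1`) and `0` (`t = 0`) agree.
    have hd : Differentiable ℂ fun t : ℂ => H (w + t • v) - H (0 + t • v) :=
      (hline w v).sub (hline 0 v)
    have := hd.apply_eq_apply_of_bounded (hb.subset ?_) 1 0
    · simpa [add_comm] using this
    · rintro _ ⟨t, rfl⟩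
      exact ⟨t • v, by simp [add_comm]⟩
  obtain ⟨L, hL⟩ := exists_continuousLinearMap (f := fun v => H v - H 0) (by fun_prop)
    (fun x y => by rw [← hconst y x]; abel)
    (fun v => by simpa using ((hline 0 v).sub_const (H 0)) 0)
  exact ⟨L, H 0, fun z => by rw [hL, sub_add_cancel, hHf, Function.comp_apply]⟩

/-- The difference of the two affine lifts is continuous and `Λ`-valued, hence constant. -/
theorem linear_unique {L L' : C2 →L[ℂ] C2} {a a' : C2}
    (h : ∀ z, mk Λ (L z + a) = mk Λ (L' z + a')) : L = L' := by
  refine ContinuousLinearMap.ext fun z => ?_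
  have h1 := eq_of_mem (Λ := Λ) (f := fun z => (L z + a) - (L' z + a')) isPreconnected_univ
    (by fun_prop) (fun x _ => mk_eq_mk_iff.1 (h x)) (Set.mem_univ z) (Set.mem_univ 0)
  simp only [map_zero, zero_add, add_sub_add_comm] at h1
  simpa [sub_eq_zero] using h1

theorem linear_ext [IsZLattice ℝ Λ] {L L' : C2 →L[ℂ] C2} (h : ∀ v ∈ Λ, L v = L' v) : L = L' := by
  have h1 := LinearMap.ext_on (f := (L : C2 →ₗ[ℂ] C2).restrictScalars ℝ)
    (g := (L' : C2 →ₗ[ℂ] C2).restrictScalars ℝ) (IsZLattice.span_top (K := ℝ) (L := Λ)) h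
  refine ContinuousLinearMap.ext fun z => ?_
  exact congrArg (fun l : C2 →ₗ[ℝ] C2 => l z) h1

end ComplexTorus

/-! ## The topology of the blow-up -/

namespace Blowup

variable {M : Type*} {S : Finset M}

theorem proj_lift (p : M) : (lift p : Blowup M S).proj = p := by
  by_cases h : p ∈ S <;> simp [lift, h, proj]

theorem proj_surjective : Function.Surjective (proj : Blowup M S → M) :=
  fun p => ⟨lift p, proj_lift p⟩

theorem eq_of_proj_eq {x y : Blowup M S} (h : x.proj = y.proj) (hx : x.proj ∉ S) : x = y := by
  rcases x with ⟨p, hp⟩ | ⟨s, hs, l⟩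
  · rcases y with ⟨q, hq⟩ | ⟨t, ht, l'⟩
    · obtain rfl : p = q := h
      rfl
    · exact absurd (show p ∈ S from (show p = t from h) ▸ ht) hp
  · exact absurd hs hx

/-- A line is spanned by a vector `(1, b)` or by a vector `(b, 1)`. -/
theorem exists_mk_eq (l : Projectivization ℂ C2) :
    ∃ g ∈ ({.refl ℂ C2, .prodComm ℂ ℂ ℂ} : Set (C2 ≃L[ℂ] C2)), ∃ b : ℂ,
      Projectivization.mk ℂ (g (1, b)) (one_prod_ne_zero g b) = l := by
  refine ⟨lineCoord l, ?_, slope (lineCoord l) l.rep, mk_slope_rep _ l (lineCoord_spec l)⟩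
  unfold lineCoord
  split_ifs <;> simp

/-- Two lines have finite slope in a common linear coordinate system. -/
theorem exists_common_coord {v w : C2} (hv : v ≠ 0) (hw : w ≠ 0) :
    ∃ g : C2 ≃L[ℂ] C2, (g.symm v).1 ≠ 0 ∧ (g.symm w).1 ≠ 0 := by
  -- This shear serves the case where the two vectors span the two coordinate axes: neither the
  -- identity nor the exchange gives both a nonzero first coordinate, but the sum of coordinates
  -- does.
  let g : C2 ≃L[ℂ] C2 := ContinuousLinearEquiv.equivOfInverse
    ((ContinuousLinearMap.fst ℂ ℂ ℂ - ContinuousLinearMap.snd ℂ ℂ ℂ).prod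
      (ContinuousLinearMap.snd ℂ ℂ ℂ))
    ((ContinuousLinearMap.fst ℂ ℂ ℂ + ContinuousLinearMap.snd ℂ ℂ ℂ).prod
      (ContinuousLinearMap.snd ℂ ℂ ℂ)) (fun v => by simp) (fun v => by simp)
  have hg : ∀ v, (g.symm v).1 = v.1 + v.2 := fun v => rfl
  have hv' : v.1 = 0 → v.2 ≠ 0 := fun h h' => hv (Prod.ext h h')
  have hw' : w.1 = 0 → w.2 ≠ 0 := fun h h' => hw (Prod.ext h h')
  by_cases h1 : v.1 = 0
  · by_cases h2 : w.2 = 0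
    · refine ⟨g, ?_, ?_⟩ <;> rw [hg] <;> grind
    · exact ⟨.prodComm ℂ ℂ ℂ, by simpa using hv' h1, by simpa using h2⟩
  · by_cases h2 : w.1 = 0
    · by_cases h3 : v.2 = 0
      · refine ⟨g, ?_, ?_⟩ <;> rw [hg] <;> grind
      · exact ⟨.prodComm ℂ ℂ ℂ, by simpa using h3, by simpa using hw' h2⟩
    · exact ⟨.refl ℂ C2, by simpa using h1, by simpa using h2⟩

variable [TopologicalSpace M] [ChartedSpace C2 M]

/-- One formula covers both branches because `g (a, a * b)` vanishes at `a = 0`. It exhibits the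
blow-down map as holomorphic in these charts. -/
theorem proj_chartExc_symm {s : M} (hs : s ∈ S) (g : C2 ≃L[ℂ] C2) (z : C2) :
    ((chartExc S s hs g).symm z).proj =
      (chartAt C2 s).symm (chartAt C2 s s + g (z.1, z.1 * z.2)) := by
  by_cases h : z.1 = 0
  · have h1 : (chartExc S s hs g).symm z = exc s hs (Projectivization.mk ℂ (g (1, z.2))
        (one_prod_ne_zero g z.2)) := if_pos h
    rw [h1, h, zero_mul, show ((0, 0) : C2) = 0 from rfl, map_zero, add_zero,
      OpenPartialHomeomorph.left_inv _ (mem_chart_source C2 s)]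
    rfl
  · have h1 : (chartExc S s hs g).symm z =
        lift ((chartAt C2 s).symm (chartAt C2 s s + g (z.1, z.1 * z.2))) := if_neg h
    rw [h1, proj_lift]

theorem zero_mem_target {s : M} (hs : s ∈ S) (g : C2 ≃L[ℂ] C2) (b : ℂ) :
    (0, b) ∈ (chartExc S s hs g).target := by
  change chartAt C2 s s + g (0, 0 * b) ∈ (chartAt C2 s).target ∧
    (chartAt C2 s).symm (chartAt C2 s s + g (0, 0 * b)) ∉ (S : Set M) \ {s}
  rw [zero_mul, show ((0, 0) : C2) = 0 from rfl, map_zero, add_zero,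
    OpenPartialHomeomorph.left_inv _ (mem_chart_source C2 s)]
  exact ⟨mem_chart_target C2 s, fun h => h.2 rfl⟩

theorem chartExc_symm_zero {s : M} (hs : s ∈ S) (g : C2 ≃L[ℂ] C2) (b : ℂ) :
    (chartExc S s hs g).symm (0, b) =
      exc s hs (Projectivization.mk ℂ (g (1, b)) (one_prod_ne_zero g b)) := if_pos rfl

theorem chartOff_mem (p : M) : chartOff S (chartAt C2 p) ∈ charts M S :=
  Or.inl ⟨_, chart_mem_atlas C2 p, rfl⟩

theorem chartExc_mem {s : M} (hs : s ∈ S) (g : C2 ≃L[ℂ] C2) : chartExc S s hs g ∈ charts M S :=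
  Or.inr ⟨s, hs, g, rfl⟩

variable [T1Space M] [IsManifold 𝓘(ℂ, C2) ω M]

/-- A chart of the blow-up as an open partial homeomorphism. -/
def chart {c : PartialEquiv (Blowup M S) C2} (hc : c ∈ charts M S) :
    OpenPartialHomeomorph (Blowup M S) C2 :=
  (chartedSpaceCore M S).openPartialHomeomorph c hc

theorem chart_mem_maximalAtlas {c : PartialEquiv (Blowup M S) C2} (hc : c ∈ charts M S) :
    chart hc ∈ IsManifold.maximalAtlas 𝓘(ℂ, C2) ω (Blowup M S) := by
  refine IsManifold.subset_maximalAtlas ?_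
  exact Set.mem_iUnion₂.2 ⟨c, hc, rfl⟩

theorem isOpen_source {c : PartialEquiv (Blowup M S) C2} (hc : c ∈ charts M S) :
    IsOpen c.source := (chart hc).open_source

theorem isOpen_target {c : PartialEquiv (Blowup M S) C2} (hc : c ∈ charts M S) :
    IsOpen c.target := (chart hc).open_target

theorem contMDiffAt_chart {c : PartialEquiv (Blowup M S) C2} (hc : c ∈ charts M S)
    {x : Blowup M S} (hx : x ∈ c.source) : ContMDiffAt 𝓘(ℂ, C2) 𝓘(ℂ, C2) ω c x :=
  contMDiffAt_of_mem_maximalAtlas (chart_mem_maximalAtlas hc) hx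

theorem contMDiffAt_chart_symm {c : PartialEquiv (Blowup M S) C2} (hc : c ∈ charts M S)
    {z : C2} (hz : z ∈ c.target) : ContMDiffAt 𝓘(ℂ, C2) 𝓘(ℂ, C2) ω c.symm z :=
  contMDiffAt_symm_of_mem_maximalAtlas (chart_mem_maximalAtlas hc) hz

/-- The blow-down map is holomorphic. -/
theorem contMDiff_proj : ContMDiff 𝓘(ℂ, C2) 𝓘(ℂ, C2) ω (proj : Blowup M S → M) := by
  rintro (⟨p, hp⟩ | ⟨s, hs, l⟩)
  · have hx : (off p hp : Blowup M S) ∈ (chartOff S (chartAt C2 p)).source :=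
      ⟨mem_chart_source C2 p, hp⟩
    have h1 : ContMDiffAt 𝓘(ℂ, C2) 𝓘(ℂ, C2) ω (chartAt C2 p).symm (chartAt C2 p p) :=
      contMDiffAt_symm_of_mem_maximalAtlas (IsManifold.chart_mem_maximalAtlas p)
        (mem_chart_target C2 p)
    refine (ContMDiffAt.comp (off p hp : Blowup M S) h1
      (contMDiffAt_chart (chartOff_mem p) hx)).congr_of_eventuallyEq ?_
    filter_upwards [(isOpen_source (chartOff_mem p)).mem_nhds hx] with y hy
    exact ((chartAt C2 p).left_inv hy.1).symm
  · have hx : exc s hs l ∈ (chartExc S s hs (lineCoord l)).source := ⟨rfl, lineCoord_spec l⟩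
    have hz := (chartExc S s hs (lineCoord l)).map_source hx
    have hlin : ContDiff ℂ ω fun w : C2 => chartAt C2 s s + lineCoord l (w.1, w.1 * w.2) := by
      fun_prop
    have h1 : ContMDiffAt 𝓘(ℂ, C2) 𝓘(ℂ, C2) ω (chartAt C2 s).symm _ :=
      contMDiffAt_symm_of_mem_maximalAtlas (IsManifold.chart_mem_maximalAtlas s) hz.1
    have h3 : ContMDiffAt 𝓘(ℂ, C2) 𝓘(ℂ, C2) ω (fun w : C2 =>
        (chartAt C2 s).symm (chartAt C2 s s + lineCoord l (w.1, w.1 * w.2)))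
        (chartExc S s hs (lineCoord l) (exc s hs l)) :=
      ContMDiffAt.comp (chartExc S s hs (lineCoord l) (exc s hs l)) h1 hlin.contMDiff.contMDiffAt
    refine (h3.comp (exc s hs l)
      (contMDiffAt_chart (chartExc_mem hs _) hx)).congr_of_eventuallyEq ?_
    filter_upwards [(isOpen_source (chartExc_mem hs (lineCoord l))).mem_nhds hx] with y hy
    have h2 := proj_chartExc_symm hs (lineCoord l) (chartExc S s hs (lineCoord l) y)
    rw [PartialEquiv.left_inv _ hy] at h2
    exact h2

theorem contMDiffAt_lift {p : M} (hp : p ∉ S) :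
    ContMDiffAt 𝓘(ℂ, C2) 𝓘(ℂ, C2) ω (lift : M → Blowup M S) p := by
  have hx : (off p hp : Blowup M S) ∈ (chartOff S (chartAt C2 p)).source :=
    ⟨mem_chart_source C2 p, hp⟩
  have h1 : ContMDiffAt 𝓘(ℂ, C2) 𝓘(ℂ, C2) ω (chartAt C2 p) p :=
    contMDiffAt_of_mem_maximalAtlas (IsManifold.chart_mem_maximalAtlas p) (mem_chart_source C2 p)
  have hz : chartAt C2 p p ∈ (chartOff S (chartAt C2 p)).target :=
    (chartOff S (chartAt C2 p)).map_source hx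
  refine ((contMDiffAt_chart_symm (chartOff_mem p) hz).comp p h1).congr_of_eventuallyEq ?_
  filter_upwards [(chartAt C2 p).open_source.mem_nhds (mem_chart_source C2 p)] with q hq
  change lift q = lift ((chartAt C2 p).symm (chartAt C2 p q))
  rw [(chartAt C2 p).left_inv hq]

theorem contMDiff_exc {s : M} (hs : s ∈ S) (g : C2 ≃L[ℂ] C2) :
    ContMDiff 𝓘(ℂ, ℂ) 𝓘(ℂ, C2) ω fun b : ℂ =>
      exc s hs (Projectivization.mk ℂ (g (1, b)) (one_prod_ne_zero g b)) := by
  intro b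
  have h1 : ContMDiff 𝓘(ℂ, ℂ) 𝓘(ℂ, C2) ω fun b : ℂ => ((0, b) : C2) :=
    (contDiff_const.prodMk contDiff_id).contMDiff
  refine ((contMDiffAt_chart_symm (chartExc_mem hs g)
    (zero_mem_target hs g b)).comp b (h1 b)).congr_of_eventuallyEq ?_
  exact Filter.Eventually.of_forall fun b => (chartExc_symm_zero hs g b).symm

/-- Points with distinct images are separated downstairs. Two points of one exceptional curve lie in
a common chart, by `exists_common_coord`. -/
instance instT2Space [T2Space M] : T2Space (Blowup M S) := by
  refine ⟨fun x y hxy => ?_⟩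
  by_cases h : x.proj = y.proj
  · by_cases hx : x.proj ∈ S
    · have hy : y.proj ∈ S := h ▸ hx
      rcases x with ⟨p, hp⟩ | ⟨s, hs, l⟩
      · exact absurd hx hp
      rcases y with ⟨q, hq⟩ | ⟨t, ht, l'⟩
      · exact absurd hy hq
      obtain rfl : s = t := h
      obtain ⟨g, hg, hg'⟩ := exists_common_coord l.rep_nonzero l'.rep_nonzero
      set c := chart (chartExc_mem hs g) with hc
      have hx1 : exc s hs l ∈ c.source := ⟨rfl, hg⟩
      have hy1 : exc s hs l' ∈ c.source := ⟨rfl, hg'⟩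
      obtain ⟨u, v, hu, hv, hxu, hyv, huv⟩ := t2_separation (c.injOn.ne hx1 hy1 hxy)
      refine ⟨_, _, c.isOpen_inter_preimage hu, c.isOpen_inter_preimage hv, ⟨hx1, hxu⟩,
        ⟨hy1, hyv⟩, ?_⟩
      exact (huv.preimage c).mono Set.inter_subset_right Set.inter_subset_right
    · exact absurd (eq_of_proj_eq h hx) hxy
  · exact separated_by_continuous contMDiff_proj.continuous h

/-- The complement of the exceptional curves is dense. -/
theorem dense_proj_notMem : Dense {x : Blowup M S | x.proj ∉ S} := by
  rintro (⟨p, hp⟩ | ⟨s, hs, l⟩)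
  · exact subset_closure hp
  obtain ⟨g, -, b, rfl⟩ := exists_mk_eq l
  have hz := zero_mem_target hs g b
  rw [← chartExc_symm_zero hs g b]
  have h1 : Filter.Tendsto (fun a : ℂ => ((a, b) : C2)) (𝓝[≠] 0) (𝓝 (0, b)) :=
    (Continuous.tendsto (by fun_prop) 0).mono_left nhdsWithin_le_nhds
  refine mem_closure_of_tendsto
    ((contMDiffAt_chart_symm (chartExc_mem hs g) hz).continuousAt.tendsto.comp h1) ?_
  filter_upwards [h1.eventually ((isOpen_target (chartExc_mem hs g)).mem_nhds hz),
    self_mem_nhdsWithin] with a ha ha0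
  change ((chartExc S s hs g).symm (a, b)).proj ∉ S
  rw [proj_chartExc_symm hs g]
  exact notMem_of_target S s g ha0 ha.1 ha.2

/-- The topology of the surface is the quotient topology of the blow-up. -/
theorem isQuotientMap_proj : Topology.IsQuotientMap (proj : Blowup M S → M) := by
  refine ⟨Topology.isCoinducing_iff.2 fun V =>
    ⟨fun hV => ?_, fun hV => hV.preimage contMDiff_proj.continuous⟩, proj_surjective⟩
  refine isOpen_iff_mem_nhds.2 fun p hpV => ?_
  by_cases hp : p ∈ S
  -- Compactness of the disc of slopes `‖b‖ ≤ 1` yields one neighbourhood of `a = 0` valid for all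
  -- these slopes. The identity and the exchange together then cover all directions, as every vector
  -- has slope of norm at most `1` in one of them.
  · have hev : ∀ g : C2 ≃L[ℂ] C2, ∀ᶠ a in 𝓝 (0 : ℂ), ∀ b ∈ Metric.closedBall (0 : ℂ) 1,
        (chartAt C2 p).symm (chartAt C2 p p + g (a, a * b)) ∈ V := by
      intro g
      refine (isCompact_closedBall (0 : ℂ) 1).eventually_forall_of_forall_eventually
        fun b _ => ?_
      have hz := zero_mem_target hp g b
      have h1 := (contMDiffAt_chart_symm (chartExc_mem hp g) hz).continuousAt.preimage_mem_nhds
        (hV.mem_nhds (by rw [chartExc_symm_zero]; exact hpV))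
      filter_upwards [h1] with z h2
      rw [← proj_chartExc_symm hp g]
      exact h2
    have hev2 : ∀ᶠ v in 𝓝 (0 : C2), (chartAt C2 p).symm (chartAt C2 p p + v) ∈ V := by
      have hfst : Filter.Tendsto (Prod.fst : C2 → ℂ) (𝓝 0) (𝓝 0) := continuous_fst.tendsto 0
      have hsnd : Filter.Tendsto (Prod.snd : C2 → ℂ) (𝓝 0) (𝓝 0) := continuous_snd.tendsto 0
      -- For `x = 0` the inequality forces `y = 0`, and the convention `0 / 0 = 0` keeps the claim
      -- true.
      have key : ∀ x y : ℂ, ‖y‖ ≤ ‖x‖ → y / x ∈ Metric.closedBall (0 : ℂ) 1 ∧ x * (y / x) = y := by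
        intro x y h
        rcases eq_or_ne x 0 with rfl | hx
        · simpa [eq_comm] using h
        · refine ⟨?_, mul_div_cancel₀ y hx⟩
          rw [mem_closedBall_zero_iff, norm_div]
          exact div_le_one_of_le₀ h (norm_nonneg _)
      filter_upwards [hfst.eventually (hev (.refl ℂ C2)),
        hsnd.eventually (hev (.prodComm ℂ ℂ ℂ))] with v h1 h2
      rcases le_total ‖v.2‖ ‖v.1‖ with h | h
      · have h3 := h1 _ (key _ _ h).1
        rw [(key _ _ h).2] at h3
        exact h3
      · have h3 := h2 _ (key _ _ h).1
        rw [(key _ _ h).2] at h3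
        exact h3
    have hc : ContinuousAt (fun q => chartAt C2 p q - chartAt C2 p p) p :=
      ((chartAt C2 p).continuousAt (mem_chart_source C2 p)).sub continuousAt_const
    have hc' : Filter.Tendsto (fun q => chartAt C2 p q - chartAt C2 p p) (𝓝 p) (𝓝 0) := by
      simpa using hc.tendsto
    filter_upwards [hc'.eventually hev2,
      (chartAt C2 p).open_source.mem_nhds (mem_chart_source C2 p)] with q h1 h2
    rw [add_sub_cancel, (chartAt C2 p).left_inv h2] at h1
    exact h1
  · have h1 : lift ⁻¹' (proj ⁻¹' V : Set (Blowup M S)) ∈ 𝓝 p :=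
      (contMDiffAt_lift hp).continuousAt.preimage_mem_nhds
        (hV.mem_nhds (by rwa [Set.mem_preimage, proj_lift]))
    filter_upwards [h1] with q hq
    rwa [Set.mem_preimage, Set.mem_preimage, proj_lift] at hq

end Blowup

/-! ## Automorphisms of the blow-up of a torus -/

namespace ComplexTorus

variable {Λ : Submodule ℤ C2} [DiscreteTopology Λ]

/-- The restriction to `ℂ` of a holomorphic map from the Riemann sphere to a torus is constant. -/
theorem eq_of_contMDiff_sphere {ψ ψ' : ℂ → ComplexTorus Λ} (hψ : ContMDiff 𝓘(ℂ, ℂ) 𝓘(ℂ, C2) ω ψ)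
    (hψ' : Continuous ψ') (h : ∀ b ≠ 0, ψ b = ψ' b⁻¹) (b b' : ℂ) : ψ b = ψ b' := by
  obtain ⟨F, hF, hFψ⟩ := exists_lift hψ.continuous
  obtain ⟨F', hF', hFψ'⟩ := exists_lift hψ'
  have hd : Differentiable ℂ F := fun z => by
    refine (contDiffAt_of_mk_comp (Λ := Λ) hF.continuousAt ?_).differentiableAt (by simp)
    simp only [hFψ]
    exact hψ z
  have hconn : IsPreconnected ({0}ᶜ : Set ℂ) :=
    (isConnected_compl_singleton_of_one_lt_rank (by simp) 0).isPreconnected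
  have hF'inv : ContinuousOn (fun b : ℂ => F' b⁻¹) {0}ᶜ :=
    hF'.comp_continuousOn continuousOn_inv₀
  -- The lifts over the two affine pieces differ by a lattice vector on the connected overlap `ℂ \
  -- {0}`.
  have hconst : ∀ b : ℂ, b ≠ 0 → F b = F' b⁻¹ + (F 1 - F' 1) := by
    intro b hb
    have h1 := eq_of_mem (Λ := Λ) hconn (hF.continuousOn.sub hF'inv) (fun w hw => by
      rw [Pi.sub_apply, ← mk_eq_mk_iff, hFψ, hFψ']
      exact h w hw) (show b ∈ ({0}ᶜ : Set ℂ) from hb) (show (1 : ℂ) ∈ ({0}ᶜ : Set ℂ) from one_ne_zero)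
    simp only [Pi.sub_apply, inv_one] at h1
    rw [← h1, add_sub_cancel]
  -- The sphere is the union of the closed unit discs of its two affine pieces, so `F` is bounded.
  have hb : Bornology.IsBounded (Set.range F) := by
    have h1 := ((isCompact_closedBall (0 : ℂ) 1).image hF).isBounded
    have h2 := ((isCompact_closedBall (0 : ℂ) 1).image
      (hF'.add (continuous_const (y := F 1 - F' 1)))).isBounded
    refine (h1.union h2).subset ?_
    rintro _ ⟨b, rfl⟩
    rcases le_total ‖b‖ 1 with hb | hb
    · exact Or.inl ⟨b, mem_closedBall_zero_iff.2 hb, rfl⟩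
    · refine Or.inr ⟨b⁻¹, mem_closedBall_zero_iff.2 ?_, (hconst b ?_).symm⟩
      · rw [norm_inv]
        exact inv_le_one_of_one_le₀ hb
      · exact norm_pos_iff.1 (one_pos.trans_le hb)
  rw [← hFψ, ← hFψ, hd.apply_eq_apply_of_bounded hb b b']

end ComplexTorus

namespace Blowup

open ComplexTorus

variable {Λ : Submodule ℤ C2} [DiscreteTopology Λ] {S : Finset (ComplexTorus Λ)}

/-- A holomorphic map from the blow-up to the torus contracts the exceptional curves. -/
theorem apply_exc_eq {f : Blowup (ComplexTorus Λ) S → ComplexTorus Λ}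
    (hf : ContMDiff 𝓘(ℂ, C2) 𝓘(ℂ, C2) ω f) {s : ComplexTorus Λ} (hs : s ∈ S)
    (l l' : Projectivization ℂ C2) : f (exc s hs l) = f (exc s hs l') := by
  let ψ (g : C2 ≃L[ℂ] C2) (b : ℂ) : ComplexTorus Λ :=
    f (exc s hs (Projectivization.mk ℂ (g (1, b)) (one_prod_ne_zero g b)))
  have hψ : ∀ g, ContMDiff 𝓘(ℂ, ℂ) 𝓘(ℂ, C2) ω (ψ g) := fun g => hf.comp (contMDiff_exc hs g)
  -- The vector `(1, b)` is `b` times `(b⁻¹, 1)`, so the two affine coordinates on the curve are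
  -- inverse to each other.
  have h1 : ∀ b ≠ 0, ψ (.refl ℂ C2) b = ψ (.prodComm ℂ ℂ ℂ) b⁻¹ := by
    intro b hb
    refine congrArg (fun l => f (exc s hs l)) ((Projectivization.mk_eq_mk_iff' ..).2 ⟨b, ?_⟩)
    ext <;> simp [hb]
  have h2 : ∀ b ≠ 0, ψ (.prodComm ℂ ℂ ℂ) b = ψ (.refl ℂ C2) b⁻¹ := fun b hb => by
    rw [h1 _ (inv_ne_zero hb), inv_inv]
  have h3 : ∀ l, f (exc s hs l) = ψ (.refl ℂ C2) 1 := by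
    intro l
    obtain ⟨g, rfl | rfl, b, rfl⟩ := exists_mk_eq l
    · exact eq_of_contMDiff_sphere (hψ _) (hψ _).continuous h1 b 1
    · refine (eq_of_contMDiff_sphere (hψ _) (hψ _).continuous h2 b 1).trans ?_
      rw [h2 1 one_ne_zero, inv_one]
  rw [h3, h3]

/-- The self-map of the torus induced by an automorphism of its blow-up. -/
def descendFun (A : HolAut (Blowup (ComplexTorus Λ) S)) (p : ComplexTorus Λ) : ComplexTorus Λ :=
  (A (lift p)).proj

variable (A B : HolAut (Blowup (ComplexTorus Λ) S))

/-- Over `S` the arbitrary point chosen by `lift` is harmless, since `proj ∘ A` is constant on each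
exceptional curve. -/
theorem descendFun_proj (x : Blowup (ComplexTorus Λ) S) :
    descendFun A x.proj = (A x).proj := by
  rcases x with ⟨p, hp⟩ | ⟨s, hs, l⟩
  · simp only [descendFun, proj, lift_of_notMem hp]
  · have h : (lift s : Blowup (ComplexTorus Λ) S) = exc s hs _ := dif_pos hs
    change (A (lift s)).proj = _
    rw [h]
    exact apply_exc_eq (contMDiff_proj.comp A.contMDiff) hs _ _

theorem descendFun_mul (p : ComplexTorus Λ) :
    descendFun (A * B) p = descendFun A (descendFun B p) := by
  obtain ⟨x, rfl⟩ := proj_surjective (S := S) p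
  rw [descendFun_proj, descendFun_proj, descendFun_proj, HolAut.mul_apply]

theorem descendFun_one (p : ComplexTorus Λ) :
    descendFun (1 : HolAut (Blowup (ComplexTorus Λ) S)) p = p := by
  obtain ⟨x, rfl⟩ := proj_surjective (S := S) p
  exact descendFun_proj 1 x

theorem continuous_descendFun : Continuous (descendFun A) := by
  rw [isQuotientMap_proj (S := S).continuous_iff]
  have h : descendFun A ∘ proj = proj ∘ A := funext (descendFun_proj A)
  rw [h]
  exact contMDiff_proj.continuous.comp A.contMDiff.continuous

theorem exists_affine [IsZLattice ℝ Λ] : ∃ (L : C2 →L[ℂ] C2) (a : C2),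
    ∀ z, descendFun A (mk Λ z) = mk Λ (L z + a) :=
  ComplexTorus.exists_affine (continuous_descendFun A) S fun p hp =>
    (contMDiff_proj.comp A.contMDiff (lift p)).comp p (contMDiffAt_lift hp)

theorem contMDiff_descendFun [IsZLattice ℝ Λ] :
    ContMDiff 𝓘(ℂ, C2) 𝓘(ℂ, C2) ω (descendFun A) := by
  obtain ⟨L, a, h⟩ := exists_affine A
  refine contMDiff_of_comp_mk ?_
  simp only [h]
  exact contMDiff_mk.comp (L.contDiff.add contDiff_const).contMDiff

/-- Otherwise `A` would map a whole exceptional curve into the fibre over a point outside `S`, which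
is a single point. This contradicts injectivity. -/
theorem descendFun_mem {s : ComplexTorus Λ} (hs : s ∈ S) : descendFun A s ∈ S := by
  by_contra h
  have h1 : ∀ l, (A (exc s hs l)).proj = descendFun A s :=
    fun l => (descendFun_proj A (exc s hs l)).symm
  have h2 : ∀ l l', l = l' := fun l l' => by
    have h3 := eq_of_proj_eq ((h1 l).trans (h1 l').symm) (by rwa [h1])
    simpa using EquivLike.injective A h3
  have h4 := h2 (Projectivization.mk ℂ ((1, 0) : C2) (by simp))
    (Projectivization.mk ℂ ((0, 1) : C2) (by simp))
  obtain ⟨c, hc⟩ := (Projectivization.mk_eq_mk_iff' ..).1 h4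
  simpa using congrArg Prod.fst hc

theorem descendFun_inv_apply (p : ComplexTorus Λ) : descendFun A⁻¹ (descendFun A p) = p := by
  rw [← descendFun_mul, inv_mul_cancel, descendFun_one]

theorem descendFun_apply_inv (p : ComplexTorus Λ) : descendFun A (descendFun A⁻¹ p) = p := by
  rw [← descendFun_mul, mul_inv_cancel, descendFun_one]

theorem descendFun_mem_iff {p : ComplexTorus Λ} : descendFun A p ∈ S ↔ p ∈ S :=
  ⟨fun h => descendFun_inv_apply A p ▸ descendFun_mem A⁻¹ h, descendFun_mem A⟩

-- Off the exceptional curves `proj` is injective, so `A` and `B` agree on a dense set, and the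
-- blow-up is Hausdorff.
variable {A B} in
theorem eq_of_descendFun_eq (h : ∀ p, descendFun A p = descendFun B p) : A = B := by
  refine DFunLike.ext _ _ (congrFun (Continuous.ext_on dense_proj_notMem A.contMDiff.continuous
    B.contMDiff.continuous fun x hx => ?_))
  refine eq_of_proj_eq ?_ ?_
  · rw [← descendFun_proj, ← descendFun_proj, h]
  · rwa [← descendFun_proj, descendFun_mem_iff]

theorem image_exceptionalCurve (s : ComplexTorus Λ) :
    A '' exceptionalCurve S s = exceptionalCurve S (descendFun A s) := by
  ext y
  constructor
  · rintro ⟨x, rfl, rfl⟩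
    exact (descendFun_proj A x).symm
  · intro (hy : y.proj = _)
    refine ⟨A⁻¹ y, ?_, EquivLike.apply_inv_apply A y⟩
    change (A⁻¹ y).proj = s
    rw [← descendFun_proj, hy, descendFun_inv_apply]

variable [IsZLattice ℝ Λ]

/-- The automorphism of the torus induced by an automorphism of its blow-up. -/
def descendAut : HolAut (ComplexTorus Λ) :=
  show Diffeomorph 𝓘(ℂ, C2) 𝓘(ℂ, C2) (ComplexTorus Λ) (ComplexTorus Λ) ω from
  { toFun := descendFun A
    invFun := descendFun A⁻¹
    left_inv := descendFun_inv_apply A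
    right_inv := descendFun_apply_inv A
    contMDiff_toFun := contMDiff_descendFun A
    contMDiff_invFun := contMDiff_descendFun A⁻¹ }

variable (S) in
/-- Automorphisms of the blow-up descend to the torus. -/
def descendHom : HolAut (Blowup (ComplexTorus Λ) S) →* HolAut (ComplexTorus Λ) :=
  MonoidHom.mk' (fun A => descendAut A) fun A B =>
    DFunLike.ext (descendAut (A * B)) (descendAut A * descendAut B) (descendFun_mul A B)

/-! ### Linear parts and the action on the lattice -/

/-- The linear part of the affine map induced by an automorphism. -/
def linearPart : C2 →L[ℂ] C2 := (exists_affine A).choose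

/-- A translation part of the affine map induced by an automorphism. -/
def translationPart : C2 := (exists_affine A).choose_spec.choose

theorem descendFun_mk (z : C2) :
    descendFun A (mk Λ z) = mk Λ (linearPart A z + translationPart A) :=
  (exists_affine A).choose_spec.choose_spec z

theorem linearPart_mem {v : C2} (hv : v ∈ Λ) : linearPart A v ∈ Λ := linear_mem (descendFun_mk A) hv

/-- The linear part is picked by choice; `linear_unique` makes it multiplicative. The translation
part is well defined only modulo `Λ`. -/
theorem linearPart_mul : linearPart (A * B) = linearPart A * linearPart B := by
  refine linear_unique (Λ := Λ) (a := translationPart (A * B))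
    (a' := linearPart A (translationPart B) + translationPart A) fun z => ?_
  rw [← descendFun_mk, descendFun_mul, descendFun_mk, descendFun_mk, map_add, add_assoc]
  rfl

theorem linearPart_one : linearPart (1 : HolAut (Blowup (ComplexTorus Λ) S)) = 1 := by
  refine linear_unique (Λ := Λ) (a := translationPart (1 : HolAut (Blowup (ComplexTorus Λ) S)))
    (a' := 0) fun z => ?_
  rw [← descendFun_mk, descendFun_one, add_zero]
  rfl

variable (S) in
/-- The linear part as a homomorphism. -/
def linearHom : HolAut (Blowup (ComplexTorus Λ) S) →* (C2 →L[ℂ] C2) where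
  toFun A := linearPart A
  map_one' := linearPart_one
  map_mul' A B := linearPart_mul A B

variable (S) in
/-- The action of the linear part on the lattice. -/
def latticeEndHom : HolAut (Blowup (ComplexTorus Λ) S) →* Module.End ℤ Λ where
  toFun A := ((linearPart A : C2 →ₗ[ℂ] C2).restrictScalars ℤ).restrict fun _ => linearPart_mem A
  map_one' := by
    ext v : 2
    change linearPart 1 (v : C2) = v
    rw [linearPart_one]
    rfl
  map_mul' A B := by
    ext v : 2
    change linearPart (A * B) (v : C2) = linearPart A (linearPart B v)
    rw [linearPart_mul]
    rfl

variable (S) in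
/-- The action of the automorphisms of the blow-up on the lattice. -/
def latticeHom : HolAut (Blowup (ComplexTorus Λ) S) →* (Λ ≃ₗ[ℤ] Λ) :=
  -- A monoid homomorphism out of a group lands in the units, which supplies the inverses.
  (LinearMap.GeneralLinearGroup.generalLinearEquiv ℤ Λ).toMonoidHom.comp
    (latticeEndHom S).toHomUnits

/-- The linear part as an automorphism of `ℂ²`. -/
def linearEquiv : C2 ≃L[ℂ] C2 :=
  ContinuousLinearEquiv.unitsEquiv ℂ C2 ((linearHom S).toHomUnits A)

theorem linearEquiv_apply (z : C2) : linearEquiv A z = linearPart A z :=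
  ContinuousLinearEquiv.unitsEquiv_apply ℂ C2 _ z

variable {A B}

theorem linearPart_eq_of_latticeHom_eq (h : latticeHom S A = latticeHom S B) :
    linearPart A = linearPart B :=
  linear_ext (Λ := Λ) fun v hv =>
    congrArg (fun f : Λ ≃ₗ[ℤ] Λ => ((f ⟨v, hv⟩ : Λ) : C2)) h

theorem eq_of_linearPart_eq (h : linearPart A = linearPart B) {s : ComplexTorus Λ}
    (hs : descendFun A s = descendFun B s) : A = B := by
  refine eq_of_descendFun_eq fun p => ?_
  obtain ⟨z, rfl⟩ := mk_surjective Λ p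
  obtain ⟨w, rfl⟩ := mk_surjective Λ s
  rw [descendFun_mk, descendFun_mk, mk_eq_mk_iff, h, add_sub_add_left_eq_sub] at hs ⊢
  exact hs

-- Elements of the kernel share their linear part, so the image of `s` in the finite set `S`
-- separates them.
variable (S) in
theorem finite_ker_latticeHom {s : ComplexTorus Λ} (hs : s ∈ S) : Finite (latticeHom S).ker := by
  refine Finite.of_injective (β := S)
    (fun A => ⟨descendFun (A : HolAut (Blowup (ComplexTorus Λ) S)) s, descendFun_mem _ hs⟩)
    fun A B h => Subtype.ext ?_
  refine eq_of_linearPart_eq (linearPart_eq_of_latticeHom_eq ?_) (congrArg Subtype.val h)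
  rw [A.2, B.2]

end Blowup

/-! ## Discreteness -/

namespace ComplexTorus

variable {Λ : Submodule ℤ C2}

/-- A connected set in a small neighbourhood of a discrete subgroup has small diameter. -/
theorem norm_sub_lt_of_isPreconnected {K : Set C2} (hK : IsPreconnected K) {δ ε : ℝ}
    (hδ : ∀ v ∈ Λ, ‖v‖ < δ → v = 0) (hε : 2 * ε ≤ δ) (hKΛ : ∀ w ∈ K, ∃ v ∈ Λ, ‖w - v‖ < ε)
    {w w' : C2} (hw : w ∈ K) (hw' : w' ∈ K) : ‖w - w'‖ < 2 * ε := by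
  obtain ⟨v, hv, hwv⟩ := hKΛ w hw
  -- Since `2 * ε ≤ δ`, the `ε`-ball about `v` is disjoint from those about the other lattice
  -- points, so the connected set `K` stays in it.
  have hsub : K ⊆ Metric.ball v ε := by
    refine hK.subset_left_of_subset_union Metric.isOpen_ball
      (isOpen_biUnion (s := {u | u ∈ Λ ∧ u ≠ v}) (f := fun u => Metric.ball u ε)
        fun _ _ => Metric.isOpen_ball) ?_ ?_ ⟨w, hw, mem_ball_iff_norm.2 hwv⟩
    · rw [Set.disjoint_iUnion₂_right]
      rintro u ⟨hu, huv⟩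
      refine Set.disjoint_left.2 fun x hx hx' => huv ?_
      rw [mem_ball_iff_norm] at hx hx'
      refine sub_eq_zero.1 (hδ _ (Λ.sub_mem hu hv) ?_)
      calc ‖u - v‖ = ‖(x - v) - (x - u)‖ := by congr 1; abel
        _ ≤ ‖x - v‖ + ‖x - u‖ := norm_sub_le _ _
        _ < δ := by linarith
    · intro x hx
      obtain ⟨u, hu, hxu⟩ := hKΛ x hx
      rcases eq_or_ne u v with rfl | huv
      · exact Or.inl (mem_ball_iff_norm.2 hxu)
      · exact Or.inr (Set.mem_biUnion (show u ∈ {u | u ∈ Λ ∧ u ≠ v} from ⟨hu, huv⟩)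
          (mem_ball_iff_norm.2 hxu))
  have hw'v := mem_ball_iff_norm.1 (hsub hw')
  calc ‖w - w'‖ = ‖(w - v) - (w' - v)‖ := by congr 1; abel
    _ ≤ ‖w - v‖ + ‖w' - v‖ := norm_sub_le _ _
    _ < 2 * ε := by linarith

theorem exists_pos_norm_lt_imp_eq_zero (Λ : Submodule ℤ C2) [DiscreteTopology Λ] :
    ∃ δ > 0, ∀ v ∈ Λ, ‖v‖ < δ → v = 0 := by
  have h3 : ({0} : Set Λ) ∈ 𝓝 (0 : Λ) := (isOpen_discrete _).mem_nhds rfl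
  obtain ⟨δ, hδ, h⟩ := Metric.mem_nhds_iff.1 h3
  exact ⟨δ, hδ, fun v hv hvδ => congrArg Subtype.val
    (show (⟨v, hv⟩ : Λ) = 0 from h (mem_ball_zero_iff.2 hvδ))⟩

/-- For every ball there is `ε > 0` such that the linear part of an affine self-map of the torus is
determined by the restriction of that map to the ball up to an error of `ε`. -/
theorem exists_pos_linear_eq (Λ : Submodule ℤ C2) [DiscreteTopology Λ] [IsZLattice ℝ Λ] (z₀ : C2)
    {r : ℝ} (hr : 0 < r) : ∃ ε > 0, ∀ (L L' : C2 →L[ℂ] C2) (a a' : C2),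
      (∀ v ∈ Λ, L v ∈ Λ) → (∀ v ∈ Λ, L' v ∈ Λ) → (∀ z ∈ Metric.closedBall z₀ r,
        mk Λ (L z + a) - mk Λ (L' z + a') ∈ mk Λ '' Metric.ball 0 ε) → L = L' := by
  obtain ⟨δ, hδ, hδΛ⟩ := exists_pos_norm_lt_imp_eq_zero Λ
  obtain ⟨s, hs⟩ := ZLattice.FG ℝ Λ
  obtain ⟨R, hR⟩ := (s.finite_toSet.image norm).bddAbove
  have hR' : ∀ v ∈ s, ‖v‖ ≤ max R r := fun v hv =>
    (hR (Set.mem_image_of_mem _ hv)).trans (le_max_left _ _)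
  have hRpos : 0 < max R r := lt_max_of_lt_right hr
  -- Scaling by `r / max R r` brings every generator into the ball of radius `r`, where `L - L'` has
  -- norm below `2 * ε`. Undoing the scaling leaves less than `δ`, so this lattice vector is zero.
  -- The maximum with `r` keeps the ratio at most `1`, hence `2 * ε ≤ δ`.
  refine ⟨δ * (r / max R r) / 2, by positivity, fun L L' a a' hL hL' h => ?_⟩
  have hε : 2 * (δ * (r / max R r) / 2) ≤ δ := by
    rw [mul_div_cancel₀ _ two_ne_zero]
    exact mul_le_of_le_one_right hδ.le (div_le_one_of_le₀ (le_max_right _ _) hRpos.le)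
  have hK : IsPreconnected ((fun z => (L z + a) - (L' z + a')) '' Metric.closedBall z₀ r) :=
    (convex_closedBall z₀ r).isPreconnected.image _ (by fun_prop)
  have hKΛ : ∀ w ∈ (fun z => (L z + a) - (L' z + a')) '' Metric.closedBall z₀ r,
      ∃ v ∈ Λ, ‖w - v‖ < δ * (r / max R r) / 2 := by
    rintro _ ⟨z, hz, rfl⟩
    obtain ⟨u, hu, hu'⟩ := h z hz
    refine ⟨(L z + a) - (L' z + a') - u, mk_eq_mk_iff.1 hu'.symm, ?_⟩
    rw [sub_sub_cancel]
    exact mem_ball_zero_iff.1 hu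
  have hball : ∀ v, ‖v‖ ≤ r → ‖L v - L' v‖ < δ * (r / max R r) := by
    intro v hv
    have h1 := norm_sub_lt_of_isPreconnected hK hδΛ hε hKΛ
      ⟨z₀ + v, by simpa using hv, rfl⟩ ⟨z₀, by simpa using hr.le, rfl⟩
    rw [mul_div_cancel₀ _ two_ne_zero] at h1
    convert h1 using 2
    simp only [map_add]
    abel
  have hgen : ∀ v ∈ s, L v = L' v := by
    intro v hv
    have hvΛ : v ∈ Λ := hs ▸ Submodule.subset_span hv
    refine sub_eq_zero.1 (hδΛ _ (Λ.sub_mem (hL v hvΛ) (hL' v hvΛ)) ?_)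
    have h1 := hball (((r / max R r : ℝ) : ℂ) • v) (by
      rw [norm_smul, Complex.norm_real, Real.norm_of_nonneg (by positivity), div_mul_comm]
      exact mul_le_of_le_one_left hr.le (div_le_one_of_le₀ (hR' v hv) hRpos.le))
    rw [map_smul, map_smul, ← smul_sub, norm_smul, Complex.norm_real,
      Real.norm_of_nonneg (by positivity), mul_comm] at h1
    exact lt_of_mul_lt_mul_right h1 (by positivity)
  refine linear_ext (Λ := Λ) fun v hv => ?_
  rw [← hs] at hv
  exact LinearMap.eqOn_span (f := (L : C2 →ₗ[ℂ] C2).restrictScalars ℤ)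
    (g := (L' : C2 →ₗ[ℂ] C2).restrictScalars ℤ) (fun v hv => hgen v hv) hv

/-- This provides a compact set on which `lift` is continuous, as needed to use the compact-open
topology. -/
theorem exists_closedBall_notMem [DiscreteTopology Λ] (S : Finset (ComplexTorus Λ)) :
    ∃ (z₀ : C2) (r : ℝ), 0 < r ∧ ∀ z ∈ Metric.closedBall z₀ r, mk Λ z ∉ S := by
  obtain ⟨t, ht⟩ := (eventually_line_notMem S 0 (v := ((1, 0) : C2)) (by simp) 0).exists
  have hopen : IsOpen (mk Λ ⁻¹' (S : Set (ComplexTorus Λ))ᶜ) :=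
    S.finite_toSet.isClosed.isOpen_compl.preimage continuous_mk
  obtain ⟨r, hr, h⟩ := Metric.nhds_basis_closedBall.mem_iff.1 (hopen.mem_nhds ht)
  exact ⟨_, r, hr, h⟩

end ComplexTorus

namespace Blowup

open ComplexTorus

variable {Λ : Submodule ℤ C2} [DiscreteTopology Λ] {S : Finset (ComplexTorus Λ)}

theorem continuous_descendFun_apply (p : ComplexTorus Λ) :
    Continuous fun A : HolAut (Blowup (ComplexTorus Λ) S) => descendFun A p := by
  have h : Continuous fun A : HolAut (Blowup (ComplexTorus Λ) S) =>
      (⟨A, A.contMDiff.continuous⟩ : C(_, _)) := continuous_induced_dom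
  have h' : Continuous fun A : HolAut (Blowup (ComplexTorus Λ) S) => A (lift p) :=
    h.eval_const (lift p)
  exact contMDiff_proj.continuous.comp h'

/-- The automorphisms of the blow-up whose descent to the torus is uniformly close to a given one
on a compact set avoiding the centres form an open set. -/
theorem isOpen_setOf_descendFun_sub_mem {K : Set C2} (hK : IsCompact K) (hKS : ∀ z ∈ K, mk Λ z ∉ S)
    (A : HolAut (Blowup (ComplexTorus Λ) S)) {U : Set (ComplexTorus Λ)} (hU : IsOpen U) :
    IsOpen {B : HolAut (Blowup (ComplexTorus Λ) S) |
      ∀ z ∈ K, descendFun B (mk Λ z) - descendFun A (mk Λ z) ∈ U} := by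
  have : CompactSpace K := isCompact_iff_compactSpace.1 hK
  let j : C(K, Blowup (ComplexTorus Λ) S) := ⟨fun z => lift (mk Λ z), continuous_iff_continuousAt.2
    fun z => ((contMDiffAt_lift (hKS z z.2)).continuousAt.comp
      (f := fun z : K => mk Λ z) (continuous_mk.comp continuous_subtype_val).continuousAt)⟩
  let π : C(Blowup (ComplexTorus Λ) S, ComplexTorus Λ) := ⟨proj, contMDiff_proj.continuous⟩
  let Φ (B : HolAut (Blowup (ComplexTorus Λ) S)) : C(K, ComplexTorus Λ) :=
    π.comp ((⟨B, B.contMDiff.continuous⟩ : C(_, _)).comp j)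
  have hΦ : Continuous Φ := (π.continuous_postcomp.comp j.continuous_precomp).comp
    continuous_induced_dom
  have h1 : IsOpen {f : C(K, ComplexTorus Λ) | Set.MapsTo f Set.univ U} :=
    ContinuousMap.isOpen_setOfPred_mapsTo isCompact_univ hU
  have h2 : Continuous fun B => Φ B - Φ A := hΦ.sub continuous_const
  convert h1.preimage h2 using 1
  ext B
  exact ⟨fun h z _ => h z z.2, fun h z hz => h (Set.mem_univ (⟨z, hz⟩ : K))⟩

-- Two open conditions isolate `A`: closeness on a ball fixes the linear part, and avoiding the
-- finitely many other points of `S` fixes the image of `s`.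
variable (S) in
theorem discreteTopology_holAut [IsZLattice ℝ Λ] {s : ComplexTorus Λ} (hs : s ∈ S) :
    DiscreteTopology (HolAut (Blowup (ComplexTorus Λ) S)) := by
  refine discreteTopology_iff_isOpen_singleton.2 fun A => ?_
  obtain ⟨z₀, r, hr, hball⟩ := exists_closedBall_notMem S
  obtain ⟨ε, hε, h⟩ := exists_pos_linear_eq Λ z₀ hr
  have h1 := isOpen_setOf_descendFun_sub_mem (isCompact_closedBall z₀ r) hball A
    (isCoveringMap_mk.isLocalHomeomorph.isOpenMap _ (Metric.isOpen_ball (x := (0 : C2)) (ε := ε)))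
  have hclosed : IsClosed ((S : Set (ComplexTorus Λ)) \ {descendFun A s}) :=
    (S.finite_toSet.sdiff).isClosed
  have h2 := hclosed.isOpen_compl.preimage (continuous_descendFun_apply (S := S) s)
  convert h1.inter h2 using 1
  symm
  rw [Set.eq_singleton_iff_unique_mem]
  refine ⟨⟨fun z _ => ?_, fun h => h.2 rfl⟩, ?_⟩
  · rw [sub_self]
    exact ⟨0, Metric.mem_ball_self hε, rfl⟩
  · rintro B ⟨hB1, hB2⟩
    refine eq_of_linearPart_eq (s := s) (h _ _ (translationPart B) (translationPart A)
      (fun v => linearPart_mem B) (fun v => linearPart_mem A) fun z hz => ?_) ?_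
    · rw [← descendFun_mk, ← descendFun_mk]
      exact hB1 z hz
    · by_contra hne
      exact hB2 ⟨descendFun_mem B hs, hne⟩

end Blowup

end

theorem mainTheorem9 (Λ : Submodule ℤ C2) [DiscreteTopology Λ] [IsZLattice ℝ Λ]
    (n : ℕ) (hn : 0 < n) (S : Finset (ComplexTorus Λ)) (hS : S.card = n) :
    -- the automorphism group of the blow-up is discrete
    DiscreteTopology (HolAut (Blowup (ComplexTorus Λ) S)) ∧
    -- automorphisms descend to the torus, and act on the lattice
    ∃ (descend : HolAut (Blowup (ComplexTorus Λ) S) →* HolAut (ComplexTorus Λ))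
      (lin : HolAut (Blowup (ComplexTorus Λ) S) →* (Λ ≃ₗ[ℤ] Λ)),
      Function.Injective descend ∧
      (∀ A x, (A x).proj = descend A x.proj) ∧
      (∀ A, descend A '' (S : Set (ComplexTorus Λ)) = S) ∧
      (∀ A : HolAut (Blowup (ComplexTorus Λ) S), ∀ s ∈ S, A '' Blowup.exceptionalCurve S s =
        Blowup.exceptionalCurve S (descend A s)) ∧
      (∀ A, ∃ (L : C2 ≃L[ℂ] C2) (a : C2), (∀ v : Λ, L v = lin A v) ∧
        ∀ z : C2, descend A (QuotientAddGroup.mk z) = QuotientAddGroup.mk (L z + a)) ∧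
      (∀ s ∈ S, Set.InjOn lin {A | descend A s = s}) ∧
      Finite lin.ker ∧
      (n = 1 → Function.Injective lin) := by

  obtain ⟨s₀, hs₀⟩ : S.Nonempty := Finset.card_pos.1 (hS ▸ hn)
  have hinj : ∀ s ∈ S, Set.InjOn (Blowup.latticeHom S) {A | Blowup.descendHom S A s = s} :=
    fun s _ A hA B hB h => Blowup.eq_of_linearPart_eq
      (Blowup.linearPart_eq_of_latticeHom_eq h) (hA.trans hB.symm)
  refine ⟨Blowup.discreteTopology_holAut S hs₀, Blowup.descendHom S, Blowup.latticeHom S,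
    fun A B h => Blowup.eq_of_descendFun_eq fun p => ?_,
    fun A x => (Blowup.descendFun_proj A x).symm, fun A => ?_,
    fun A s _ => Blowup.image_exceptionalCurve A s,
    fun A => ⟨Blowup.linearEquiv A, Blowup.translationPart A,
      fun v => Blowup.linearEquiv_apply A v, fun z => ?_⟩, hinj,
    Blowup.finite_ker_latticeHom S hs₀, fun h1 A B h => ?_⟩
  · exact congrArg (fun f : HolAut (ComplexTorus Λ) => f p) h
  · ext p
    constructor
    · rintro ⟨s, hs, rfl⟩
      exact Blowup.descendFun_mem A hs
    · exact fun hp => ⟨Blowup.descendFun A⁻¹ p, Blowup.descendFun_mem _ hp,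
        Blowup.descendFun_apply_inv A p⟩
  · rw [Blowup.linearEquiv_apply]
    exact Blowup.descendFun_mk A z
  -- When `S` is a singleton, every automorphism fixes its point.
  · have hfix : ∀ C : HolAut (Blowup (ComplexTorus Λ) S), Blowup.descendHom S C s₀ = s₀ :=
      fun C => Finset.card_le_one.1 (hS.trans h1).le _ (Blowup.descendFun_mem C hs₀) _ hs₀
    exact hinj s₀ hs₀ (hfix A) (hfix B) h
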